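/- **Theorem (concentration inequality for the test-train process).** Let $u,m\ge 1$ be integers, $n=u+m$, let $\mathcal X,\mathcal Y$ be sets and $(x_1,y_1),\dots,(x_n,y_n)\in\mathcal X\times\mathcal Y$ a full sample. For $h:\mathcal X\times\mathcal Y\to\mathbb R$ write $h(i)=h(x_i,y_i)$, and put $$\mathcal L_n(h)=\frac1n\sum_{i=1}^n h(i),\qquad T_n(h)=\frac1n\sum_{i=1}^n h(i)^2 .$$ *Sampling.* Let $d=(d_1,\dots,d_u)$ be a random vector with independent coordinates, $d_i$ uniformly distributed on $\{i,i+1,\dots,n\}$. The vector $Z_d=(Z_d(1),\dots,Z_d(u))$ is produced from $d$ by the RANDPERM algorithm: start with the array $I=(1,\dots,n)$ and for $i=1,\dots,u$ set $Z_d(i)=I(d_i)$ and then swap the values of $I(i)$ and $I(d_i)$. (So $Z_d$ consists of the first $u$ entries of a uniformly random permutation of $\{1,\dots,n\}$.) Let $\{Z_d\}$ be the set of entries of $Z_d$ (test indices) and $\overline{Z_d}=\{1,\dots,n\}\setminus\{Z_d\}$ (training indices). The test and training losses of $h$ are $$\mathcal U^{(u)}_h(Z_d)=\frac1u\sum_{i\in\{Z_d\}}h(i),\qquad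 \mathcal L^{(m)}_h(\overline{Z_d})=\frac1m\sum_{i\in\overline{Z_d}}h(i).$$ *Function class.* Let $\mathcal H$ be a non-empty class of functions $h:\mathcal X\times\mathcal Y\to\mathbb R$ and let $H_0\ge 2\sqrt2$ be such that $|h(i)|\le H_0$ for all $h\in\mathcal H$ and all $i\in\{1,\dots,n\}$. Put $\mathcal H_1=\{h^2: h\in\mathcal H\}$. The test-train process is $$g(d)=\sup_{h\in\mathcal H}\bigl(\mathcal U^{(u)}_h(Z_d)-\mathcal L^{(m)}_h(\overline{Z_d})\bigr).$$ For a function class $\mathcal G$ the transductive complexities are $$\mathfrak R^+_u(\mathcal G)=\mathbb E_d\Bigl[\sup_{h\in\mathcal G}\bigl(\mathcal U^{(u)}_h(Z_d)-\mathcal L_n(h)\bigr)\Bigr],\qquad \mathfrak R^+_m(\mathcal G)=\mathbb E_d\Bigl[\sup_{h\in\mathcal G}\bigl(\mathcal L^{(m)}_h(\overline{Z_d})-\mathcal L_n(h)\bigr)\Bigr],$$ and $\mathfrak R^+_{\min\{u,m\}}$ denotes $\mathfrak R^+_u$ if $u\le m$ and $\mathfrak R^+_m$ if $m\le u$ (the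 two agree when $u=m$). *Claim.* Suppose that $r>0$ and $$\sup_{h\in\mathcal H}T_n(h)=\sup_{h\in\mathcal H}\frac1n\sum_{i=1}^n h(i)^2\le r .$$ Then for every $x>0$, with probability at least $1-e^{-x}$ over $d$, $$g(d)\le \mathbb E_d[g(d)]+8\sqrt{\frac{3rx}{\min\{u,m\}}}+\inf_{\alpha>0}\left(\frac{4\,\mathfrak R^+_{\min\{u,m\}}(\mathcal H_1)}{\alpha}+\frac{4\alpha x}{\min\{u,m\}}\right)+\frac{8H_0^2x}{\min\{u,m\}} .$$ -/

import Mathlib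

open MeasureTheory

noncomputable section

/-- The possible draws `d = (d_1, ..., d_u)`, where `d_i` ranges over the positions from `i` to `n`,
`n = u + m` (positions are numbered from `0`). -/
abbrev Draws (u m : ℕ) : Type :=
  (i : Fin u) → {j : Fin (u + m) // Fin.castAdd m i ≤ j}

instance drawsNonempty (u m : ℕ) (i : Fin u) :
    Nonempty {j : Fin (u + m) // Fin.castAdd m i ≤ j} :=
  ⟨⟨Fin.castAdd m i, le_refl _⟩⟩

/-- The law of `d`: the coordinates `d_i` are independent, each uniform on its range. -/
def drawLaw (u m : ℕ) : Measure (Draws u m) :=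
  Measure.pi fun i : Fin u =>
    (PMF.uniformOfFintype {j : Fin (u + m) // Fin.castAdd m i ≤ j}).toMeasure

instance drawLawIsProbabilityMeasure (u m : ℕ) : IsProbabilityMeasure (drawLaw u m) := by
  unfold drawLaw
  infer_instance

/-- The array `I` of RANDPERM after `k` steps, as a map from positions to values. It starts as the
identity, and step `k` swaps the values at the positions `k` and `d_k`. -/
def randpermArray {u m : ℕ} (d : Draws u m) : ℕ → Equiv.Perm (Fin (u + m))
  | 0 => 1
  | k + 1 =>
    if hk : k < u then
      randpermArray d k * Equiv.swap (Fin.castAdd m ⟨k, hk⟩) (d ⟨k, hk⟩).1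
    else randpermArray d k

/-- The output vector `Z_d` of RANDPERM: `Z_d(i) = I(d_i)`, read before the swap of step `i`. -/
def randperm {u m : ℕ} (d : Draws u m) (i : Fin u) : Fin (u + m) :=
  randpermArray d i.val (d i).1

/-- The set of test indices `{Z_d}`. -/
def testSet {u m : ℕ} (d : Draws u m) : Finset (Fin (u + m)) :=
  Finset.univ.image (randperm d)

/-- The set of training indices, the complement of `{Z_d}`. -/
def trainSet {u m : ℕ} (d : Draws u m) : Finset (Fin (u + m)) :=
  (testSet d)ᶜ

section Losses

variable {𝒳 𝒴 : Type*} {u m : ℕ}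

/-- The test loss `U_h^{(u)}(Z_d)` on the full sample `S`. -/
def testLoss (S : Fin (u + m) → 𝒳 × 𝒴) (h : 𝒳 × 𝒴 → ℝ) (d : Draws u m) : ℝ :=
  (1 / (u : ℝ)) * ∑ i ∈ testSet d, h (S i)

/-- The training loss `L_h^{(m)}` on the complement of `Z_d`. -/
def trainLoss (S : Fin (u + m) → 𝒳 × 𝒴) (h : 𝒳 × 𝒴 → ℝ) (d : Draws u m) : ℝ :=
  (1 / (m : ℝ)) * ∑ i ∈ trainSet d, h (S i)

/-- The average loss `L_n(h)` over the full sample. -/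
def avgLoss (S : Fin (u + m) → 𝒳 × 𝒴) (h : 𝒳 × 𝒴 → ℝ) : ℝ :=
  (1 / ((u + m : ℕ) : ℝ)) * ∑ i, h (S i)

/-- The average squared loss `T_n(h)` over the full sample. -/
def avgSqLoss (S : Fin (u + m) → 𝒳 × 𝒴) (h : 𝒳 × 𝒴 → ℝ) : ℝ :=
  (1 / ((u + m : ℕ) : ℝ)) * ∑ i, h (S i) ^ 2

/-- The test-train process `g(d)`. -/
def testTrain (S : Fin (u + m) → 𝒳 × 𝒴) (H : Set (𝒳 × 𝒴 → ℝ)) (d : Draws u m) : ℝ :=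
  ⨆ h : H, (testLoss S h.1 d - trainLoss S h.1 d)

/-- The transductive complexity `R^+_u(H)`. -/
def transComplexityTest (S : Fin (u + m) → 𝒳 × 𝒴) (H : Set (𝒳 × 𝒴 → ℝ)) : ℝ :=
  ∫ d, ⨆ h : H, (testLoss S h.1 d - avgLoss S h.1) ∂(drawLaw u m)

/-- The transductive complexity `R^+_m(H)`. -/
def transComplexityTrain (S : Fin (u + m) → 𝒳 × 𝒴) (H : Set (𝒳 × 𝒴 → ℝ)) : ℝ :=
  ∫ d, ⨆ h : H, (trainLoss S h.1 d - avgLoss S h.1) ∂(drawLaw u m)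

/-- The transductive complexity `R^+_{min(u,m)}(H)`. If `u = m`, then `R^+_u(H) = R^+_m(H)`, because
the test set and the training set are then both uniform among the subsets of the same size. -/
def transComplexityMin (S : Fin (u + m) → 𝒳 × 𝒴) (H : Set (𝒳 × 𝒴 → ℝ)) : ℝ :=
  if u ≤ m then transComplexityTest S H else transComplexityTrain S H

/-- The squared class `H_1 = {h² : h ∈ H}`. -/
def sqClass (H : Set (𝒳 × 𝒴 → ℝ)) : Set (𝒳 × 𝒴 → ℝ) :=
  (fun h => h ^ 2) '' H

end Losses

end

/-! The test set is a uniform `u`-subset of the `n = u + m` indices, so the statement is a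
concentration inequality on the slice. It is obtained by the entropy method, from a modified
logarithmic Sobolev inequality for the dynamics that exchange an index inside `A` for one outside
(`slice_modified_log_sobolev`): `n` times the entropy of `F` is at most its entropy production. The
proof is an induction on `n`. One conditions on whether `k ∈ A`, applies the induction hypothesis to
both conditional slices, bounds the entropy of the indicator by joint convexity, and averages over
`k`.

For `F = exp (t g)` this bounds the entropy by the squared positive decrements of `g` under
exchanges (`slice_entropy_exp_le`). Write `N = min u m`. For the test-train supremum `g` the
decrements are controlled by `3 r + W`, where `W` is the centered supremum of the squared class over
the smaller part. Now `W` is random, but it is self-bounding: its own decrements are controlled by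
`r + W`. Herbst's argument therefore bounds an exponential moment of `W` through its mean `R`, which
is the complexity of the squared class. The variational formula for the entropy (`sum_exp_mul_le`)
replaces `W` by this bound at the cost of a multiple of the entropy of `exp (t g)`, which is
absorbed on the left. A second Herbst argument and Chernoff's bound give a sub-gamma tail
(`slice_concentration`), and the AM-GM inequality turns `√(R x / N)` into the infimum over `α`. -/

/-! ### Convexity inequalities for entropy and entropy production. -/

/-- The log-sum inequality. -/
theorem log_sum_inequality {κ : Type*} (s : Finset κ) (x y : κ → ℝ)
    (hx : ∀ i ∈ s, 0 < x i) (hy : ∀ i ∈ s, 0 < y i) :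
    (∑ i ∈ s, x i) * (Real.log (∑ i ∈ s, x i) - Real.log (∑ i ∈ s, y i)) ≤
      ∑ i ∈ s, x i * (Real.log (x i) - Real.log (y i)) := by
  rcases s.eq_empty_or_nonempty with rfl | hs
  · simp
  set X := ∑ i ∈ s, x i with hX
  set Y := ∑ i ∈ s, y i with hY
  have hXp : 0 < X := Finset.sum_pos hx hs
  have hYp : 0 < Y := Finset.sum_pos hy hs
  -- This is `log z ≤ z - 1` at `z = (X / Y) y i / x i`. The corrections `x i - (X / Y) y i` sum to
  -- zero.
  have key : ∀ i ∈ s, x i * (Real.log X - Real.log Y) + (x i - X / Y * y i) ≤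
      x i * (Real.log (x i) - Real.log (y i)) := by
    intro i hi
    have h1 := hx i hi
    have h2 := hy i hi
    have h3 := Real.log_le_sub_one_of_pos (x := X / Y * y i / x i) (by positivity)
    rw [Real.log_div (by positivity) (by positivity), Real.log_mul (by positivity) (by positivity),
      Real.log_div (by positivity) (by positivity)] at h3
    have h4 := mul_le_mul_of_nonneg_left h3 h1.le
    have h5 : x i * (X / Y * y i / x i - 1) = X / Y * y i - x i := by
      field_simp
    rw [h5] at h4
    linarith
  have h := Finset.sum_le_sum key
  rw [Finset.sum_add_distrib, Finset.sum_sub_distrib, ← Finset.sum_mul, ← Finset.mul_sum, ← hX,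
    ← hY, div_mul_cancel₀ X hYp.ne', sub_self, add_zero] at h
  exact h

/-- The integrand `(x - y) (log x - log y)` of the entropy production. -/
noncomputable def entropyProduction (x y : ℝ) : ℝ := (x - y) * (Real.log x - Real.log y)

theorem entropyProduction_nonneg {x y : ℝ} (hx : 0 < x) (hy : 0 < y) :
    0 ≤ entropyProduction x y := by
  unfold entropyProduction
  rcases le_total x y with h | h
  · exact mul_nonneg_of_nonpos_of_nonpos (by linarith) (by linarith [Real.log_le_log hx h])
  · exact mul_nonneg (by linarith) (by linarith [Real.log_le_log hy h])

/-- Joint convexity in homogeneous form: the log-sum inequality is applied in both directions and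
the results are added. -/
theorem entropyProduction_sum_le {κ : Type*} (s : Finset κ) (x y : κ → ℝ)
    (hx : ∀ i ∈ s, 0 < x i) (hy : ∀ i ∈ s, 0 < y i) :
    entropyProduction (∑ i ∈ s, x i) (∑ i ∈ s, y i) ≤
      ∑ i ∈ s, entropyProduction (x i) (y i) := by
  have h1 := log_sum_inequality s x y hx hy
  have h2 := log_sum_inequality s y x hy hx
  have h3 : ∑ i ∈ s, entropyProduction (x i) (y i) =
      ∑ i ∈ s, x i * (Real.log (x i) - Real.log (y i)) +
        ∑ i ∈ s, y i * (Real.log (y i) - Real.log (x i)) := by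
    rw [← Finset.sum_add_distrib]
    exact Finset.sum_congr rfl fun i _ => by unfold entropyProduction; ring
  rw [h3]
  unfold entropyProduction
  linarith

theorem entropyProduction_mul {c x y : ℝ} (hc : 0 < c) (hx : 0 < x) (hy : 0 < y) :
    entropyProduction (c * x) (c * y) = c * entropyProduction x y := by
  unfold entropyProduction
  rw [Real.log_mul hc.ne' hx.ne', Real.log_mul hc.ne' hy.ne']
  ring

/-- The entropy of a function on a two-point space, in unnormalized form. -/
theorem two_point_entropy_le {α β p q : ℝ} (hα : 0 < α) (hβ : 0 < β) (hp : 0 < p) (hq : 0 < q) :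
    p * α * Real.log α + q * β * Real.log β -
        (p * α + q * β) * Real.log ((p * α + q * β) / (p + q)) ≤
      p * q / (p + q) * entropyProduction α β := by
  have hpq : 0 < p + q := by positivity
  -- Concavity bounds the logarithm of the mean from below by the mean of the logarithms; after this
  -- replacement both sides agree.
  have hconc := strictConcaveOn_log_Ioi.concaveOn.2 (Set.mem_Ioi.2 hα) (Set.mem_Ioi.2 hβ)
    (show 0 ≤ p / (p + q) by positivity) (show 0 ≤ q / (p + q) by positivity)
    (by rw [← add_div, div_self hpq.ne'])
  simp only [smul_eq_mul] at hconc
  have e : p / (p + q) * α + q / (p + q) * β = (p * α + q * β) / (p + q) := by ring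
  rw [e] at hconc
  have h := mul_le_mul_of_nonneg_left hconc (show 0 ≤ p * α + q * β by positivity)
  refine le_trans (sub_le_sub_left h _) (le_of_eq ?_)
  unfold entropyProduction
  field_simp
  ring

/-- The entropy of `F` under the uniform distribution on `P`, multiplied by the cardinality
of `P`. -/
noncomputable def sumEntropy {α : Type*} (P : Finset α) (F : α → ℝ) : ℝ :=
  ∑ A ∈ P, F A * Real.log (F A) - (∑ A ∈ P, F A) * Real.log ((∑ A ∈ P, F A) / (P.card : ℝ))

/-! ### Modified logarithmic Sobolev inequality on the slice. -/

section Slice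

variable {ι : Type*} [DecidableEq ι]

/-- The set `A` with `i` exchanged for `j`. -/
def exchange (A : Finset ι) (i j : ι) : Finset ι := insert j (A.erase i)

theorem sum_powersetCard_succ_erase {s : Finset ι} {k : ι} (hk : k ∈ s) (v : ℕ)
    (f : Finset ι → ℝ) :
    ∑ A ∈ s.powersetCard (v + 1), f A =
      ∑ A ∈ (s.erase k).powersetCard v, f (insert k A) +
        ∑ A ∈ (s.erase k).powersetCard (v + 1), f A := by
  conv_lhs => rw [← Finset.insert_erase hk]
  rw [Finset.powersetCard_succ_insert (Finset.notMem_erase k s), Finset.sum_union, add_comm,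
    Finset.sum_image]
  · intro A hA B hB hAB
    have h1 : k ∉ A := fun h => Finset.notMem_erase k s ((Finset.mem_powersetCard.1 hA).1 h)
    have h2 : k ∉ B := fun h => Finset.notMem_erase k s ((Finset.mem_powersetCard.1 hB).1 h)
    rw [← Finset.erase_insert h1, ← Finset.erase_insert h2, hAB]
  · rw [Finset.disjoint_left]
    intro A hA hA'
    obtain ⟨B, -, rfl⟩ := Finset.mem_image.1 hA'
    exact Finset.notMem_erase k s ((Finset.mem_powersetCard.1 hA).1 (Finset.mem_insert_self k B))

/-- The entropy production of `F` for the exchange dynamics on the `u`-subsets of `s`. -/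
noncomputable def sliceProduction (s : Finset ι) (u : ℕ) (F : Finset ι → ℝ) : ℝ :=
  ∑ A ∈ s.powersetCard u, ∑ i ∈ A, ∑ j ∈ s \ A, entropyProduction (F A) (F (exchange A i j))

theorem sliceProduction_nonneg (s : Finset ι) (u : ℕ) (F : Finset ι → ℝ) (hF : ∀ A, 0 < F A) :
    0 ≤ sliceProduction s u F :=
  Finset.sum_nonneg fun _ _ => Finset.sum_nonneg fun _ _ => Finset.sum_nonneg fun _ _ =>
    entropyProduction_nonneg (hF _) (hF _)

/-- A pair `(i, j)` survives the removal of `k` unless `k` is `i` or `j`, and these are two distinct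
elements of `s`. -/
theorem sum_erase_sum_erase {s A : Finset ι} (hA : A ⊆ s) (f : ι → ι → ℝ) :
    ∑ k ∈ s, ∑ i ∈ A.erase k, ∑ j ∈ (s \ A).erase k, f i j =
      ((s.card : ℝ) - 2) * ∑ i ∈ A, ∑ j ∈ s \ A, f i j := by
  have h1 : ∀ k ∈ s, ∑ i ∈ A.erase k, ∑ j ∈ (s \ A).erase k, f i j =
      ∑ i ∈ A, ∑ j ∈ s \ A, if k ≠ i ∧ k ≠ j then f i j else 0 := by
    intro k _
    rw [← Finset.filter_ne, Finset.sum_filter]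
    refine Finset.sum_congr rfl fun i _ => ?_
    rw [← Finset.filter_ne, Finset.sum_filter]
    by_cases h : k = i <;> simp [h]
  rw [Finset.sum_congr rfl h1, Finset.sum_comm, Finset.mul_sum]
  refine Finset.sum_congr rfl fun i hi => ?_
  rw [Finset.sum_comm, Finset.mul_sum]
  refine Finset.sum_congr rfl fun j hj => ?_
  rw [← Finset.sum_filter, Finset.sum_const, nsmul_eq_mul]
  congr 1
  have hij : i ≠ j := fun h => (Finset.mem_sdiff.1 hj).2 (h ▸ hi)
  have hc : s.filter (fun k => k ≠ i ∧ k ≠ j) = (s.erase i).erase j := by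
    ext k; simp only [Finset.mem_filter, Finset.mem_erase]; tauto
  have hj' : j ∈ s.erase i := Finset.mem_erase.2 ⟨hij.symm, (Finset.mem_sdiff.1 hj).1⟩
  have e1 := Finset.card_erase_add_one hj'
  have e2 := Finset.card_erase_add_one (hA hi)
  rw [hc, ← e2, ← e1]
  push_cast
  ring

/-- Fixing the status of `k` leaves exactly the exchanges that do not move `k`, so each exchange is
counted `#s - 2` times. -/
theorem sum_sliceProduction_erase (s : Finset ι) (v : ℕ) (F : Finset ι → ℝ) :
    ∑ k ∈ s, (sliceProduction (s.erase k) v (fun A => F (insert k A)) +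
        sliceProduction (s.erase k) (v + 1) F) =
      ((s.card : ℝ) - 2) * sliceProduction s (v + 1) F := by
  have h1 : ∀ k ∈ s, sliceProduction (s.erase k) v (fun A => F (insert k A)) +
      sliceProduction (s.erase k) (v + 1) F =
      ∑ A ∈ s.powersetCard (v + 1), ∑ i ∈ A.erase k, ∑ j ∈ (s \ A).erase k,
        entropyProduction (F A) (F (exchange A i j)) := by
    intro k hk
    rw [sum_powersetCard_succ_erase hk]
    unfold sliceProduction
    congr 1
    · refine Finset.sum_congr rfl fun A hA => ?_
      have hkA : k ∉ A := fun h => Finset.notMem_erase k s ((Finset.mem_powersetCard.1 hA).1 h)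
      rw [Finset.erase_insert hkA]
      have hs : (s \ insert k A).erase k = s.erase k \ A := by
        ext j; simp only [Finset.mem_erase, Finset.mem_sdiff, Finset.mem_insert]; tauto
      rw [hs]
      refine Finset.sum_congr rfl fun i hi => Finset.sum_congr rfl fun j hj => ?_
      have hki : k ≠ i := fun h => hkA (h ▸ hi)
      unfold exchange
      rw [Finset.erase_insert_of_ne hki, Finset.insert_comm]
    · refine Finset.sum_congr rfl fun A hA => ?_
      have hkA : k ∉ A := fun h => Finset.notMem_erase k s ((Finset.mem_powersetCard.1 hA).1 h)
      rw [Finset.erase_eq_of_notMem hkA]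
      have hs : (s \ A).erase k = s.erase k \ A := by
        ext j; simp only [Finset.mem_erase, Finset.mem_sdiff]; tauto
      rw [hs]
  rw [Finset.sum_congr rfl h1, Finset.sum_comm]
  unfold sliceProduction
  rw [Finset.mul_sum]
  exact Finset.sum_congr rfl fun A hA =>
    sum_erase_sum_erase (Finset.mem_powersetCard.1 hA).1 _

/-- Double counting of the pairs `(A, j)` with `A` a `v`-subset and `j ∉ A`. -/
theorem sum_powersetCard_sum_insert (t : Finset ι) (v : ℕ) (f : Finset ι → ℝ) :
    ∑ A ∈ t.powersetCard v, ∑ j ∈ t \ A, f (insert j A) =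
      ((v : ℝ) + 1) * ∑ B ∈ t.powersetCard (v + 1), f B := by
  have h : ∀ B ∈ t.powersetCard (v + 1), ((v : ℝ) + 1) * f B = ∑ _j ∈ B, f B := by
    intro B hB
    rw [Finset.sum_const, (Finset.mem_powersetCard.1 hB).2, nsmul_eq_mul]
    push_cast; ring
  rw [Finset.mul_sum, Finset.sum_congr rfl h, Finset.sum_sigma', Finset.sum_sigma']
  refine Finset.sum_bij' (fun x _ => ⟨insert x.2 x.1, x.2⟩) (fun x _ => ⟨x.1.erase x.2, x.2⟩)
    ?_ ?_ ?_ ?_ ?_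
  · rintro ⟨A, j⟩ h
    simp only [Finset.mem_sigma, Finset.mem_powersetCard, Finset.mem_sdiff] at h ⊢
    obtain ⟨⟨h1, h2⟩, h3, h4⟩ := h
    exact ⟨⟨Finset.insert_subset h3 h1, by rw [Finset.card_insert_of_notMem h4, h2]⟩,
      Finset.mem_insert_self _ _⟩
  · rintro ⟨B, j⟩ h
    simp only [Finset.mem_sigma, Finset.mem_powersetCard, Finset.mem_sdiff] at h ⊢
    obtain ⟨⟨h1, h2⟩, h3⟩ := h
    exact ⟨⟨(Finset.erase_subset _ _).trans h1, by rw [Finset.card_erase_of_mem h3, h2]; rfl⟩,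
      h1 h3, Finset.notMem_erase _ _⟩
  · rintro ⟨A, j⟩ h
    simp only [Finset.mem_sigma, Finset.mem_sdiff] at h
    simp [Finset.erase_insert h.2.2]
  · rintro ⟨B, j⟩ h
    simp only [Finset.mem_sigma] at h
    simp [Finset.insert_erase h.2]
  · rintro ⟨A, j⟩ _
    rfl

/-- The part of the entropy that comes from the indicator of `k ∈ A`. -/
theorem indicator_entropy_le {s : Finset ι} {k : ι} (hk : k ∈ s) (v : ℕ) (hv : v + 1 < s.card)
    (F : Finset ι → ℝ) (hF : ∀ A, 0 < F A) :
    sumEntropy (s.powersetCard (v + 1)) F -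
        (sumEntropy ((s.erase k).powersetCard v) (fun A => F (insert k A)) +
          sumEntropy ((s.erase k).powersetCard (v + 1)) F) ≤
      1 / (s.card : ℝ) * ∑ A ∈ (s.erase k).powersetCard v, ∑ j ∈ s.erase k \ A,
        entropyProduction (F (insert k A)) (F (insert j A)) := by
  set t := s.erase k with ht
  have htc : t.card + 1 = s.card := Finset.card_erase_add_one hk
  set a := ∑ A ∈ t.powersetCard v, F (insert k A) with ha
  set b := ∑ A ∈ t.powersetCard (v + 1), F A with hb
  have hM1 : (0 : ℝ) < ((t.powersetCard v).card : ℝ) := by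
    rw [Finset.card_powersetCard]; exact_mod_cast Nat.choose_pos (by omega)
  have hM0 : (0 : ℝ) < ((t.powersetCard (v + 1)).card : ℝ) := by
    rw [Finset.card_powersetCard]; exact_mod_cast Nat.choose_pos (by omega)
  have hM : ((s.powersetCard (v + 1)).card : ℝ) =
      ((t.powersetCard v).card : ℝ) + ((t.powersetCard (v + 1)).card : ℝ) := by
    have := sum_powersetCard_succ_erase hk v (fun _ => (1 : ℝ))
    simpa using this
  -- Both sides count the pairs `(A, j)` with `A` a `v`-subset of `t` and `j ∈ t \ A`.
  have hrat : ((t.powersetCard v).card : ℝ) * ((s.card : ℝ) - (v + 1)) =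
      ((t.powersetCard (v + 1)).card : ℝ) * (v + 1) := by
    have h0 := sum_powersetCard_sum_insert t v (fun _ => (1 : ℝ))
    rw [Finset.sum_const _ (s := t.powersetCard (v + 1)), nsmul_eq_mul, mul_one] at h0
    rw [mul_comm _ ((v : ℝ) + 1), ← h0]
    have h : ∀ A ∈ t.powersetCard v, ∑ _j ∈ t \ A, (1 : ℝ) = (s.card : ℝ) - (v + 1) := by
      intro A hA
      have h1 := Finset.card_sdiff_add_card_eq_card (Finset.mem_powersetCard.1 hA).1
      have h2 := (Finset.mem_powersetCard.1 hA).2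
      rw [Finset.sum_const, nsmul_eq_mul, mul_one, ← htc, ← h1, h2]
      push_cast; ring
    rw [Finset.sum_congr rfl h, Finset.sum_const, nsmul_eq_mul]
  have hap : 0 < a := Finset.sum_pos (fun _ _ => hF _)
    (Finset.card_pos.1 (by exact_mod_cast hM1))
  have hbp : 0 < b := Finset.sum_pos (fun _ _ => hF _)
    (Finset.card_pos.1 (by exact_mod_cast hM0))
  set M1 : ℝ := ((t.powersetCard v).card : ℝ) with hM1d
  set M0 : ℝ := ((t.powersetCard (v + 1)).card : ℝ) with hM0d
  have hn : (0 : ℝ) < (s.card : ℝ) := by exact_mod_cast (by omega : 0 < s.card)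
  have hm : (0 : ℝ) < (s.card : ℝ) - (v + 1) := by
    have : ((v + 1 : ℕ) : ℝ) < (s.card : ℝ) := by exact_mod_cast hv
    push_cast at this; linarith
  have hv1 : (0 : ℝ) < (v : ℝ) + 1 := by positivity
  -- Joint convexity over the pairs `(A, j)`. Each `A` occurs `#s - (v + 1)` times and each `insert
  -- j A` arises `v + 1` times; by `hrat` the two multiples of `a` and `b` have a common factor
  -- times the conditional means.
  have hjoint : entropyProduction (((s.card : ℝ) - (v + 1)) * a) (((v : ℝ) + 1) * b) ≤
      ∑ A ∈ t.powersetCard v, ∑ j ∈ t \ A,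
        entropyProduction (F (insert k A)) (F (insert j A)) := by
    have h := entropyProduction_sum_le ((t.powersetCard v).sigma fun A => t \ A)
      (fun x => F (insert k x.1)) (fun x => F (insert x.2 x.1)) (fun _ _ => hF _) (fun _ _ => hF _)
    rw [Finset.sum_sigma, Finset.sum_sigma, Finset.sum_sigma] at h
    convert h using 2
    · rw [ha, Finset.mul_sum]
      refine Finset.sum_congr rfl fun A hA => ?_
      have h1 := Finset.card_sdiff_add_card_eq_card (Finset.mem_powersetCard.1 hA).1
      have h2 := (Finset.mem_powersetCard.1 hA).2
      dsimp only
      rw [Finset.sum_const, nsmul_eq_mul, ← htc, ← h1, h2]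
      push_cast; ring
    · rw [hb, sum_powersetCard_sum_insert]
  have e1 : ((s.card : ℝ) - (v + 1)) * a = (M1 * ((s.card : ℝ) - (v + 1))) * (a / M1) := by
    field_simp
  have e2 : ((v : ℝ) + 1) * b = (M1 * ((s.card : ℝ) - (v + 1))) * (b / M0) := by
    rw [hrat]; field_simp
  rw [e1, e2, entropyProduction_mul (by positivity) (by positivity) (by positivity)] at hjoint
  have h2 := two_point_entropy_le (α := a / M1) (β := b / M0) (by positivity) (by positivity)
    hM1 hM0
  rw [mul_div_cancel₀ a hM1.ne', mul_div_cancel₀ b hM0.ne'] at h2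
  have hent : sumEntropy (s.powersetCard (v + 1)) F -
      (sumEntropy (t.powersetCard v) (fun A => F (insert k A)) +
        sumEntropy (t.powersetCard (v + 1)) F) =
      a * Real.log (a / M1) + b * Real.log (b / M0) - (a + b) * Real.log ((a + b) / (M1 + M0)) := by
    unfold sumEntropy
    rw [sum_powersetCard_succ_erase hk v F,
      sum_powersetCard_succ_erase hk v (fun A => F A * Real.log (F A)), hM]
    simp only [← ha, ← hb, ← ht]
    ring
  rw [hent]
  refine h2.trans ?_
  have hc : M1 * M0 / (M1 + M0) = 1 / (s.card : ℝ) * (M1 * ((s.card : ℝ) - (v + 1))) := by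
    rw [hrat, div_eq_iff (by positivity), mul_assoc, one_div, eq_inv_mul_iff_mul_eq₀ hn.ne']
    linear_combination M0 * hrat
  rw [hc, mul_assoc]
  exact mul_le_mul_of_nonneg_left hjoint (by positivity)

/-- Every exchange removes exactly one index, so the exchanges that remove `k`, summed over `k`,
exhaust the dynamics. -/
theorem sum_erase_insert_production (s : Finset ι) (v : ℕ) (F : Finset ι → ℝ) :
    ∑ k ∈ s, ∑ A ∈ (s.erase k).powersetCard v, ∑ j ∈ s.erase k \ A,
        entropyProduction (F (insert k A)) (F (insert j A)) =
      sliceProduction s (v + 1) F := by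
  have h1 : ∀ k ∈ s, ∑ A ∈ (s.erase k).powersetCard v, ∑ j ∈ s.erase k \ A,
        entropyProduction (F (insert k A)) (F (insert j A)) =
      ∑ A ∈ s.powersetCard (v + 1), if k ∈ A then ∑ j ∈ s \ A,
        entropyProduction (F A) (F (exchange A k j)) else 0 := by
    intro k hk
    rw [sum_powersetCard_succ_erase hk]
    have h0 : ∑ A ∈ (s.erase k).powersetCard (v + 1), (if k ∈ A then ∑ j ∈ s \ A,
        entropyProduction (F A) (F (exchange A k j)) else 0) = 0 := by
      refine Finset.sum_eq_zero fun A hA => if_neg fun h => ?_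
      exact Finset.notMem_erase k s ((Finset.mem_powersetCard.1 hA).1 h)
    rw [h0, add_zero]
    refine Finset.sum_congr rfl fun A hA => ?_
    have hkA : k ∉ A := fun h => Finset.notMem_erase k s ((Finset.mem_powersetCard.1 hA).1 h)
    rw [if_pos (Finset.mem_insert_self k A)]
    have hs : s \ insert k A = s.erase k \ A := by
      ext j; simp only [Finset.mem_erase, Finset.mem_sdiff, Finset.mem_insert]; tauto
    rw [hs]
    refine Finset.sum_congr rfl fun j _ => ?_
    unfold exchange
    rw [Finset.erase_insert hkA]
  rw [Finset.sum_congr rfl h1, Finset.sum_comm]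
  unfold sliceProduction
  refine Finset.sum_congr rfl fun A hA => ?_
  rw [← Finset.sum_filter]
  congr 1
  ext k
  simp only [Finset.mem_filter]
  exact ⟨fun h => h.2, fun h => ⟨(Finset.mem_powersetCard.1 hA).1 h, h⟩⟩

/-- The modified logarithmic Sobolev inequality for uniform `u`-subsets of `s`. -/
theorem slice_modified_log_sobolev (s : Finset ι) (u : ℕ) (F : Finset ι → ℝ)
    (hF : ∀ A, 0 < F A) :
    (s.card : ℝ) * sumEntropy (s.powersetCard u) F ≤ sliceProduction s u F := by
  induction hn : s.card generalizing s u F with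
  | zero => simpa using sliceProduction_nonneg s u F hF
  | succ n ih =>
    have hsingle : ∀ B, s.powersetCard u = {B} →
        ((n + 1 : ℕ) : ℝ) * sumEntropy (s.powersetCard u) F ≤ sliceProduction s u F := by
      intro B hB
      have : sumEntropy (s.powersetCard u) F = 0 := by simp [sumEntropy, hB]
      rw [this, mul_zero]
      exact sliceProduction_nonneg s u F hF
    rcases Nat.eq_zero_or_pos u with rfl | hu
    · exact hsingle ∅ (Finset.powersetCard_zero s)
    rcases lt_trichotomy u s.card with hlt | heq | hgt
    · obtain ⟨v, rfl⟩ : ∃ v, u = v + 1 := ⟨u - 1, by omega⟩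
      have hnpos : (0 : ℝ) < n := by exact_mod_cast (by omega : 0 < n)
      have hI : ∀ k ∈ s, (n : ℝ) * (sumEntropy (s.powersetCard (v + 1)) F) ≤
          (sliceProduction (s.erase k) v (fun A => F (insert k A)) +
            sliceProduction (s.erase k) (v + 1) F) +
          (n : ℝ) / (n + 1) * ∑ A ∈ (s.erase k).powersetCard v, ∑ j ∈ s.erase k \ A,
            entropyProduction (F (insert k A)) (F (insert j A)) := by
        intro k hk
        have hc : (s.erase k).card = n := by
          have := Finset.card_erase_add_one hk; omega
        have i1 := ih (s.erase k) v (fun A => F (insert k A)) (fun _ => hF _) hc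
        have i2 := ih (s.erase k) (v + 1) F hF hc
        have i3 := mul_le_mul_of_nonneg_left (indicator_entropy_le hk v hlt F hF) hnpos.le
        rw [hn, ← mul_assoc] at i3
        push_cast at i3
        rw [mul_one_div] at i3
        linarith
      -- With `D` the entropy production, the sum over `k` reads `n (n + 1) Ent ≤ (n - 1) D + n / (n
      -- + 1) D ≤ n D`.
      have hS := Finset.sum_le_sum hI
      rw [Finset.sum_const, nsmul_eq_mul, Finset.sum_add_distrib, sum_sliceProduction_erase,
        ← Finset.mul_sum, sum_erase_insert_production, hn] at hS
      push_cast at hS ⊢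
      have hD := sliceProduction_nonneg s (v + 1) F hF
      have h1 : (n : ℝ) / (n + 1) * sliceProduction s (v + 1) F ≤ sliceProduction s (v + 1) F :=
        mul_le_of_le_one_left hD (by rw [div_le_one (by positivity)]; linarith)
      refine le_of_mul_le_mul_left ?_ hnpos
      nlinarith
    · exact hsingle s (by rw [heq, Finset.powersetCard_self])
    · have : s.powersetCard u = ∅ := Finset.powersetCard_eq_empty.2 hgt
      simp [sumEntropy, sliceProduction, this]

/-- Each exchange is undone by the opposite exchange. -/
theorem sum_exchange_symm (s : Finset ι) (u : ℕ) (f : Finset ι → Finset ι → ℝ) :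
    ∑ A ∈ s.powersetCard u, ∑ i ∈ A, ∑ j ∈ s \ A, f A (exchange A i j) =
      ∑ A ∈ s.powersetCard u, ∑ i ∈ A, ∑ j ∈ s \ A, f (exchange A i j) A := by
  have hs : ∀ φ : Finset ι → ι → ι → ℝ,
      ∑ A ∈ s.powersetCard u, ∑ i ∈ A, ∑ j ∈ s \ A, φ A i j =
      ∑ x ∈ (s.powersetCard u).sigma (fun A => A ×ˢ (s \ A)), φ x.1 x.2.1 x.2.2 := by
    intro φ
    rw [Finset.sum_sigma]
    exact Finset.sum_congr rfl fun A _ => by rw [Finset.sum_product]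
  rw [hs (fun A i j => f A (exchange A i j)), hs (fun A i j => f (exchange A i j) A)]
  have key : ∀ (A : Finset ι) (i j : ι), i ∈ A → j ∉ A →
      exchange (exchange A i j) j i = A := by
    intro A i j hi hj
    unfold exchange
    rw [Finset.erase_insert (fun h => hj (Finset.mem_of_mem_erase h)), Finset.insert_erase hi]
  have hmem : ∀ x : (_ : Finset ι) × (ι × ι),
      x ∈ (s.powersetCard u).sigma (fun A => A ×ˢ (s \ A)) →
      (⟨exchange x.1 x.2.1 x.2.2, (x.2.2, x.2.1)⟩ : (_ : Finset ι) × (ι × ι)) ∈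
        (s.powersetCard u).sigma (fun A => A ×ˢ (s \ A)) := by
    rintro ⟨A, i, j⟩ h
    simp only [Finset.mem_sigma, Finset.mem_powersetCard, Finset.mem_product,
      Finset.mem_sdiff] at h ⊢
    obtain ⟨⟨h1, h2⟩, h3, h4, h5⟩ := h
    have hij : i ≠ j := fun h => h5 (h ▸ h3)
    refine ⟨⟨?_, ?_⟩, Finset.mem_insert_self _ _, h1 h3, ?_⟩
    · exact Finset.insert_subset h4 ((Finset.erase_subset _ _).trans h1)
    · unfold exchange
      rw [Finset.card_insert_of_notMem (fun h => h5 (Finset.mem_of_mem_erase h)),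
        Finset.card_erase_add_one h3, h2]
    · simp [exchange, hij]
  refine Finset.sum_bij' (fun x _ => ⟨exchange x.1 x.2.1 x.2.2, (x.2.2, x.2.1)⟩)
    (fun x _ => ⟨exchange x.1 x.2.1 x.2.2, (x.2.2, x.2.1)⟩) (fun x h => hmem x h)
    (fun x h => hmem x h) ?_ ?_ ?_ <;>
  · rintro ⟨A, i, j⟩ h
    simp only [Finset.mem_sigma, Finset.mem_product, Finset.mem_sdiff] at h
    simp [key A i j h.2.1 h.2.2.2]

/-- By convexity, the difference of the exponentials is at most the larger one times the difference
of the exponents, so only decrements from the larger value matter. -/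
theorem entropyProduction_exp_le (a b : ℝ) :
    entropyProduction (Real.exp a) (Real.exp b) ≤
      Real.exp a * (max (a - b) 0) ^ 2 + Real.exp b * (max (b - a) 0) ^ 2 := by
  have key : ∀ x y : ℝ, y ≤ x → (Real.exp x - Real.exp y) * (x - y) ≤
      Real.exp x * (x - y) ^ 2 := by
    intro x y h
    have h1 : Real.exp x * (y - x + 1) ≤ Real.exp x * Real.exp (y - x) :=
      mul_le_mul_of_nonneg_left (Real.add_one_le_exp _) (Real.exp_pos x).le
    rw [← Real.exp_add, add_sub_cancel] at h1
    nlinarith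
  unfold entropyProduction
  rw [Real.log_exp, Real.log_exp]
  rcases le_total a b with h | h
  · rw [max_eq_right (by linarith), max_eq_left (by linarith)]
    linarith [key b a h]
  · rw [max_eq_left (by linarith), max_eq_right (by linarith)]
    linarith [key a b h]

/-- Entropy bound for the exponential of a function whose squared positive decrements under
exchanges sum up to at most `#s * V`. -/
theorem slice_entropy_exp_le (s : Finset ι) (u : ℕ) (hs : s.Nonempty) (g V : Finset ι → ℝ)
    (hV : ∀ A ∈ s.powersetCard u, ∑ i ∈ A, ∑ j ∈ s \ A, (max (g A - g (exchange A i j)) 0) ^ 2 ≤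
      s.card * V A) {t : ℝ} (ht : 0 ≤ t) :
    sumEntropy (s.powersetCard u) (fun A => Real.exp (t * g A)) ≤
      2 * t ^ 2 * ∑ A ∈ s.powersetCard u, Real.exp (t * g A) * V A := by
  have hn : (0 : ℝ) < s.card := by exact_mod_cast hs.card_pos
  have h1 := slice_modified_log_sobolev s u (fun A => Real.exp (t * g A))
    (fun _ => Real.exp_pos _)
  have h2 : sliceProduction s u (fun A => Real.exp (t * g A)) ≤
      2 * ∑ A ∈ s.powersetCard u, ∑ i ∈ A, ∑ j ∈ s \ A,
        Real.exp (t * g A) * (max (t * g A - t * g (exchange A i j)) 0) ^ 2 := by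
    -- The net effect of these rewrites is that the second of the two equal sums has its exchanges
    -- reversed, which matches the two terms of `entropyProduction_exp_le`.
    rw [two_mul]
    conv_rhs => rw [sum_exchange_symm s u (fun A B =>
      Real.exp (t * g A) * (max (t * g A - t * g B) 0) ^ 2)]
    rw [← sum_exchange_symm s u (fun A B =>
      Real.exp (t * g A) * (max (t * g A - t * g B) 0) ^ 2)]
    nth_rewrite 2 [sum_exchange_symm s u (fun A B =>
      Real.exp (t * g A) * (max (t * g A - t * g B) 0) ^ 2)]
    simp only [← Finset.sum_add_distrib]
    exact Finset.sum_le_sum fun A _ => Finset.sum_le_sum fun i _ => Finset.sum_le_sum fun j _ =>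
      entropyProduction_exp_le _ _
  have h3 : ∑ A ∈ s.powersetCard u, ∑ i ∈ A, ∑ j ∈ s \ A,
        Real.exp (t * g A) * (max (t * g A - t * g (exchange A i j)) 0) ^ 2 ≤
      ∑ A ∈ s.powersetCard u, s.card * (t ^ 2 * (Real.exp (t * g A) * V A)) := by
    refine Finset.sum_le_sum fun A hA => ?_
    have h4 : ∀ i j, Real.exp (t * g A) * (max (t * g A - t * g (exchange A i j)) 0) ^ 2 =
        Real.exp (t * g A) * t ^ 2 * (max (g A - g (exchange A i j)) 0) ^ 2 := by
      intro i j
      have : max (t * g A - t * g (exchange A i j)) 0 =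
          t * max (g A - g (exchange A i j)) 0 := by
        rw [mul_max_of_nonneg _ _ ht, mul_zero, mul_sub]
      rw [this]; ring
    simp only [h4, ← Finset.mul_sum]
    have := mul_le_mul_of_nonneg_left (hV A hA)
      (show 0 ≤ Real.exp (t * g A) * t ^ 2 by positivity)
    linarith
  rw [← Finset.mul_sum, ← Finset.mul_sum] at h3
  refine le_of_mul_le_mul_left ?_ hn
  linarith

end Slice

/-! ### Herbst's argument, Chernoff's bound and decoupling. -/

section Herbst

variable {α : Type*}

/-- The logarithm of the moment generating function of `g` under the uniform distribution
on `P`. -/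
noncomputable def logMgf (P : Finset α) (g : α → ℝ) (t : ℝ) : ℝ :=
  Real.log ((∑ A ∈ P, Real.exp (t * g A)) / (P.card : ℝ))

/-- The mean of `g` under the exponentially tilted distribution. -/
noncomputable def tiltedMean (P : Finset α) (g : α → ℝ) (t : ℝ) : ℝ :=
  (∑ A ∈ P, Real.exp (t * g A) * g A) / ∑ A ∈ P, Real.exp (t * g A)

theorem sum_exp_pos {P : Finset α} (hP : P.Nonempty) (g : α → ℝ) :
    0 < ∑ A ∈ P, Real.exp (g A) :=
  Finset.sum_pos (fun _ _ => Real.exp_pos _) hP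

theorem logMgf_zero {P : Finset α} (hP : P.Nonempty) (g : α → ℝ) : logMgf P g 0 = 0 := by
  have : (P.card : ℝ) ≠ 0 := by exact_mod_cast hP.card_pos.ne'
  simp [logMgf, this]

theorem hasDerivAt_logMgf {P : Finset α} (hP : P.Nonempty) (g : α → ℝ) (t : ℝ) :
    HasDerivAt (logMgf P g) (tiltedMean P g t) t := by
  have hc : (0 : ℝ) < P.card := by exact_mod_cast hP.card_pos
  have hZ := sum_exp_pos hP fun A => t * g A
  have h1 : HasDerivAt (fun t => ∑ A ∈ P, Real.exp (t * g A))
      (∑ A ∈ P, Real.exp (t * g A) * g A) t := by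
    refine HasDerivAt.fun_sum fun A _ => ?_
    simpa using ((hasDerivAt_id t).mul_const (g A)).exp
  have h2 := (h1.div_const (P.card : ℝ)).log (by positivity)
  have h3 : tiltedMean P g t = (∑ A ∈ P, Real.exp (t * g A) * g A) / (P.card : ℝ) /
      ((∑ A ∈ P, Real.exp (t * g A)) / (P.card : ℝ)) := by
    rw [tiltedMean, div_div_div_cancel_right₀ hc.ne']
  rw [h3]
  exact h2

/-- The normalized entropy is `t L' - L` for `L = logMgf P g`, which is `t ^ 2` times the derivative
of `L / t`. -/
theorem sumEntropy_exp {P : Finset α} (hP : P.Nonempty) (g : α → ℝ) (t : ℝ) :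
    sumEntropy P (fun A => Real.exp (t * g A)) =
      (∑ A ∈ P, Real.exp (t * g A)) * (t * tiltedMean P g t - logMgf P g t) := by
  have hZ := sum_exp_pos hP fun A => t * g A
  have h : ∑ A ∈ P, Real.exp (t * g A) * (t * g A) =
      t * ((∑ A ∈ P, Real.exp (t * g A)) * tiltedMean P g t) := by
    unfold tiltedMean
    rw [mul_div_cancel₀ _ hZ.ne', Finset.mul_sum]
    exact Finset.sum_congr rfl fun A _ => by ring
  unfold sumEntropy
  simp only [Real.log_exp]
  rw [h, logMgf]
  ring

/-- Herbst's argument. -/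
theorem logMgf_le_of_deriv_le {P : Finset α} (hP : P.Nonempty) (g : α → ℝ) {T : ℝ} {k k' : ℝ → ℝ}
    (hk0 : k 0 = 0) (hk : ContinuousOn k (Set.Ico 0 T))
    (hk' : ∀ t ∈ Set.Ioo 0 T, HasDerivAt k (k' t) t)
    (h : ∀ t ∈ Set.Ioo 0 T, t * tiltedMean P g t - logMgf P g t ≤ t ^ 2 * k' t)
    {t : ℝ} (ht : t ∈ Set.Ioo 0 T) :
    logMgf P g t ≤ t * ((∑ A ∈ P, g A) / (P.card : ℝ) + k t) := by
  set L := logMgf P g with hL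
  have hd := hasDerivAt_logMgf hP g
  -- `dslope L 0` is `L t / t`, extended to `t = 0` by `L' 0`, the mean of `g`; the hypothesis makes
  -- `f` antitone.
  set f : ℝ → ℝ := fun t => dslope L 0 t - k t with hf
  have hcont : ContinuousOn f (Set.Ico 0 T) := by
    refine ContinuousOn.sub (fun s _ => ?_) hk
    refine ContinuousAt.continuousWithinAt ?_
    rcases eq_or_ne s 0 with rfl | hs
    · exact continuousAt_dslope_same.2 (hd 0).differentiableAt
    · exact (continuousAt_dslope_of_ne hs).2 (hd s).continuousAt
  have hderiv : ∀ s ∈ Set.Ioo 0 T,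
      HasDerivAt f ((tiltedMean P g s * s - L s * 1) / s ^ 2 - k' s) s := by
    intro s hs
    refine HasDerivAt.sub ?_ (hk' s hs)
    refine ((hd s).div (hasDerivAt_id s) hs.1.ne').congr_of_eventuallyEq ?_
    filter_upwards [eventually_ne_nhds hs.1.ne'] with y hy
    rw [dslope_of_ne _ hy, slope_def_field, hL, logMgf_zero hP]
    simp
  have hanti : AntitoneOn f (Set.Ico 0 T) := by
    refine antitoneOn_of_deriv_nonpos (convex_Ico 0 T) hcont ?_ ?_
    · intro s hs
      rw [interior_Ico] at hs
      exact (hderiv s hs).differentiableAt.differentiableWithinAt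
    · intro s hs
      rw [interior_Ico] at hs
      rw [(hderiv s hs).deriv, sub_nonpos, div_le_iff₀ (by have := hs.1; positivity)]
      linarith [h s hs]
  have hle := hanti ⟨le_rfl, ht.1.trans ht.2⟩ ⟨ht.1.le, ht.2⟩ ht.1.le
  simp only [hf, dslope_same, hk0, sub_zero] at hle
  rw [dslope_of_ne _ ht.1.ne', slope_def_field, hL, logMgf_zero hP, sub_zero, sub_zero,
    sub_le_iff_le_add, div_le_iff₀ ht.1] at hle
  have h0 : tiltedMean P g 0 = (∑ A ∈ P, g A) / (P.card : ℝ) := by simp [tiltedMean]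
  rw [(hd 0).deriv, h0] at hle
  linarith

/-- Chernoff's bound for a sub-gamma logarithmic moment generating function. -/
theorem card_filter_le_of_logMgf_le [DecidableEq α] {P : Finset α} (hP : P.Nonempty) (g : α → ℝ)
    {μ q c : ℝ} (hq : 0 < q) (hc : 0 < c)
    (h : ∀ t ∈ Set.Ioo 0 (1 / c), logMgf P g t ≤ t * (μ + q * t / (1 - c * t)))
    {x : ℝ} (hx : 0 < x) :
    ((P.filter fun A => μ + 2 * Real.sqrt (q * x) + c * x < g A).card : ℝ) ≤
      Real.exp (-x) * P.card := by
  have hcard : (0 : ℝ) < P.card := by exact_mod_cast hP.card_pos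
  -- The parameter `t = s / (1 + c s)` makes the exponent in Chernoff's bound exactly `-x`.
  set s := Real.sqrt (x / q) with hs
  have hsp : 0 < s := Real.sqrt_pos.2 (by positivity)
  have hss : s ^ 2 = x / q := Real.sq_sqrt (by positivity)
  have hxs : x = q * s ^ 2 := by rw [hss]; field_simp
  have hqx : Real.sqrt (q * x) = q * s := by
    rw [Real.sqrt_eq_iff_mul_self_eq (by positivity) (by positivity), hxs]; ring
  set D := 1 + c * s with hD
  have hDp : 0 < D := by positivity
  set t := s / D with ht
  have htp : 0 < t := by positivity
  have htc : 1 - c * t = 1 / D := by rw [ht]; field_simp; rw [hD]; ring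
  have htm : t < 1 / c := by
    rw [lt_div_iff₀ hc]
    have : 0 < 1 - c * t := by rw [htc]; positivity
    linarith
  set a := μ + 2 * Real.sqrt (q * x) + c * x with ha
  have hmgf := h t ⟨htp, htm⟩
  have hexp : t * (μ + q * t / (1 - c * t)) - t * a = -x := by
    have key : ∀ σ E : ℝ, 0 < E → E = 1 + c * σ → σ / E * (μ + q * (σ / E) / (1 / E)) -
        σ / E * (μ + 2 * (q * σ) + c * (q * σ ^ 2)) = -(q * σ ^ 2) := by
      intro σ E hE hE'
      field_simp
      rw [hE']
      ring
    have hx' : -x = -(q * s ^ 2) := by rw [← hxs]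
    rw [hx', ← key s D hDp hD, htc, ha, hqx, ← hxs]
  have hZ := sum_exp_pos hP fun A => t * g A
  unfold logMgf at hmgf
  rw [Real.log_le_iff_le_exp (div_pos hZ hcard), div_le_iff₀ hcard] at hmgf
  have hmarkov : ((P.filter fun A => a < g A).card : ℝ) * Real.exp (t * a) ≤
      ∑ A ∈ P, Real.exp (t * g A) := by
    rw [← nsmul_eq_mul, ← Finset.sum_const]
    refine (Finset.sum_le_sum fun A hA => ?_).trans (Finset.sum_le_sum_of_subset_of_nonneg
      (Finset.filter_subset _ P) fun A _ _ => (Real.exp_pos (t * g A)).le)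
    exact Real.exp_le_exp.2 (mul_le_mul_of_nonneg_left (Finset.mem_filter.1 hA).2.le htp.le)
  have hfin := hmarkov.trans hmgf
  rw [← hexp, Real.exp_sub, div_mul_eq_mul_div, le_div_iff₀ (Real.exp_pos _)]
  exact hfin

/-- Decoupling of two functions through the variational formula for the entropy. -/
theorem sum_exp_mul_le {P : Finset α} (hP : P.Nonempty) (g W : α → ℝ) (t θ : ℝ) :
    θ * ∑ A ∈ P, Real.exp (t * g A) * W A ≤
      sumEntropy P (fun A => Real.exp (t * g A)) +
        (∑ A ∈ P, Real.exp (t * g A)) * logMgf P W θ := by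
  have hc : (0 : ℝ) < P.card := by exact_mod_cast hP.card_pos
  have h := log_sum_inequality P (fun A => Real.exp (t * g A)) (fun A => Real.exp (θ * W A))
    (fun _ _ => Real.exp_pos _) (fun _ _ => Real.exp_pos _)
  unfold sumEntropy logMgf
  rw [Real.log_div (sum_exp_pos hP _).ne' hc.ne', Real.log_div (sum_exp_pos hP _).ne' hc.ne']
  have e : ∑ A ∈ P, Real.exp (t * g A) *
      (Real.log (Real.exp (t * g A)) - Real.log (Real.exp (θ * W A))) =
      ∑ A ∈ P, Real.exp (t * g A) * Real.log (Real.exp (t * g A)) -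
        θ * ∑ A ∈ P, Real.exp (t * g A) * W A := by
    rw [Finset.mul_sum, ← Finset.sum_sub_distrib]
    refine Finset.sum_congr rfl fun A _ => ?_
    rw [Real.log_exp (θ * W A)]; ring
  rw [e] at h
  linarith

end Herbst

/-! ### Concentration on the slice with a self-bounding variance proxy. -/

section Concentration

variable {ι : Type*} [DecidableEq ι]

/-- The exponential moment of a function on the slice whose variance proxy is bounded by an affine
function of itself. -/
theorem slice_logMgf_le_of_self_bounding (s : Finset ι) (u : ℕ) (hs : s.Nonempty) (hu : u ≤ s.card)
    (W : Finset ι → ℝ) {b r : ℝ} (hb : 0 < b)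
    (hW : ∀ A ∈ s.powersetCard u,
      ∑ i ∈ A, ∑ j ∈ s \ A, (max (W A - W (exchange A i j)) 0) ^ 2 ≤
        s.card * (b / 2 * (r + W A))) :
    logMgf (s.powersetCard u) W (1 / (2 * b)) ≤
      1 / (2 * b) * (2 * ((∑ A ∈ s.powersetCard u, W A) / ((s.powersetCard u).card : ℝ)) + r) := by
  set P := s.powersetCard u with hP'
  have hP : P.Nonempty := Finset.powersetCard_nonempty.2 hu
  have hb2 : 0 < 1 / (2 * b) := by positivity
  -- The entropy bound is `t L' - L ≤ t ^ 2 (b L' + b r)`, whose right factor is the derivative of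
  -- `k = b L + b r t`. Any `T` beyond `1 / (2 b)` would do.
  have hL := logMgf_le_of_deriv_le hP W (T := 1 / (2 * b) + 1)
    (k := fun t => b * logMgf P W t + b * r * t) (k' := fun t => b * tiltedMean P W t + b * r * 1)
    (by simp [logMgf_zero hP])
    (fun t _ => ((((hasDerivAt_logMgf hP W t).const_mul b).add
      ((hasDerivAt_id t).const_mul (b * r))).continuousAt).continuousWithinAt)
    (fun t _ => ((hasDerivAt_logMgf hP W t).const_mul b).add
      ((hasDerivAt_id t).const_mul (b * r)))
    (fun t ht => by
      have h1 := slice_entropy_exp_le s u hs W _ hW ht.1.le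
      have hZ := sum_exp_pos hP fun A => t * W A
      rw [sumEntropy_exp hP] at h1
      have h2 : ∑ A ∈ P, Real.exp (t * W A) * (b / 2 * (r + W A)) =
          (∑ A ∈ P, Real.exp (t * W A)) * (b / 2 * (r + tiltedMean P W t)) := by
        have h3 : (∑ A ∈ P, Real.exp (t * W A)) * tiltedMean P W t =
            ∑ A ∈ P, Real.exp (t * W A) * W A := mul_div_cancel₀ _ hZ.ne'
        calc ∑ A ∈ P, Real.exp (t * W A) * (b / 2 * (r + W A))
            = b / 2 * r * ∑ A ∈ P, Real.exp (t * W A) +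
              b / 2 * ∑ A ∈ P, Real.exp (t * W A) * W A := by
              rw [Finset.mul_sum, Finset.mul_sum, ← Finset.sum_add_distrib]
              exact Finset.sum_congr rfl fun A _ => by ring
          _ = _ := by rw [← h3]; ring
      rw [h2] at h1
      refine le_of_mul_le_mul_left (h1.trans (le_of_eq ?_)) hZ
      ring)
    (t := 1 / (2 * b)) ⟨hb2, by linarith⟩
  set ψ := logMgf P W (1 / (2 * b))
  set R := (∑ A ∈ P, W A) / (P.card : ℝ)
  -- At `t = 1 / (2 b)` the term `b t L` is `L / 2`, which is absorbed on the left.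
  have e : 1 / (2 * b) * (R + (b * ψ + b * r * (1 / (2 * b)))) =
      ψ / 2 + 1 / (2 * b) * (2 * R + r) / 2 := by
    field_simp
    ring
  rw [e] at hL
  linarith

/-- Concentration on the slice for a function whose variance proxy is controlled by a
self-bounding function. -/
theorem slice_concentration (s : Finset ι) (u : ℕ) (hs : s.Nonempty) (hu : u ≤ s.card)
    (g W : Finset ι → ℝ) {N B r : ℝ} (hN : 0 < N) (hB : 8 ≤ B) (hr : 0 < r)
    (hg : ∀ A ∈ s.powersetCard u,
      ∑ i ∈ A, ∑ j ∈ s \ A, (max (g A - g (exchange A i j)) 0) ^ 2 ≤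
        s.card * (4 / N * (3 * r + W A)))
    (hW : ∀ A ∈ s.powersetCard u,
      ∑ i ∈ A, ∑ j ∈ s \ A, (max (W A - W (exchange A i j)) 0) ^ 2 ≤
        s.card * (B / N * (r + W A)))
    {R : ℝ} (hR : (∑ A ∈ s.powersetCard u, W A) / ((s.powersetCard u).card : ℝ) = R)
    (hR0 : 0 ≤ R) {x : ℝ} (hx : 0 < x) :
    (((s.powersetCard u).filter fun A =>
        (∑ A ∈ s.powersetCard u, g A) / ((s.powersetCard u).card : ℝ) +
          2 * Real.sqrt (8 * (4 * r + 2 * R) / N * x) + 2 * B / N * x < g A).card : ℝ) ≤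
      Real.exp (-x) * (s.powersetCard u).card := by
  have hψ := slice_logMgf_le_of_self_bounding s u hs hu W (b := 2 * B / N) (r := r) (by positivity)
    (fun A hA => (hW A hA).trans (le_of_eq (by ring)))
  set P := s.powersetCard u with hP'
  have hP : P.Nonempty := Finset.powersetCard_nonempty.2 hu
  rw [hR] at hψ
  set θ := 1 / (2 * (2 * B / N)) with hθ
  have hθp : 0 < θ := by positivity
  set q := 8 * (4 * r + 2 * R) / N with hq
  have hqp : 0 < q := by positivity
  set c := 2 * B / N with hc
  have hcp : 0 < c := by positivity
  refine card_filter_le_of_logMgf_le hP g hqp hcp (fun t ht => ?_) hx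
  have hpos : ∀ t ∈ Set.Ico 0 (1 / c), 0 < 1 - c * t := by
    intro t ht
    have := (lt_div_iff₀ hcp).1 ht.2
    linarith
  have hk : ∀ t ∈ Set.Ico 0 (1 / c),
      HasDerivAt (fun t => q * t / (1 - c * t)) (q / (1 - c * t) ^ 2) t := by
    intro t ht
    have h1 := ((hasDerivAt_id t).const_mul q).div
      (((hasDerivAt_id t).const_mul c).const_sub 1) (hpos t ht).ne'
    have e : q / (1 - c * t) ^ 2 =
        (q * 1 * (1 - c * t) - q * t * -(c * 1)) / (1 - c * t) ^ 2 := by ring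
    rw [e]
    exact h1
  refine logMgf_le_of_deriv_le hP g (T := 1 / c) (k := fun t => q * t / (1 - c * t))
    (k' := fun t => q / (1 - c * t) ^ 2) (by simp)
    (fun t ht => (hk t ht).continuousAt.continuousWithinAt)
    (fun t ht => hk t ⟨ht.1.le, ht.2⟩) (fun t ht => ?_) ht
  have hp := hpos t ⟨ht.1.le, ht.2⟩
  have htp := ht.1
  have hZ := sum_exp_pos hP fun A => t * g A
  have h1 := slice_entropy_exp_le s u hs g _ hg ht.1.le
  have h2 := sum_exp_mul_le hP g W t θ
  set Z := ∑ A ∈ P, Real.exp (t * g A) with hZd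
  have hent := sumEntropy_exp hP g t
  rw [← hZd] at hent
  have e1 : ∑ A ∈ P, Real.exp (t * g A) * (4 / N * (3 * r + W A)) =
      4 / N * (3 * r * Z + ∑ A ∈ P, Real.exp (t * g A) * W A) := by
    rw [hZd, Finset.mul_sum, ← Finset.sum_add_distrib, Finset.mul_sum]
    exact Finset.sum_congr rfl fun A _ => by ring
  rw [e1, hent] at h1
  rw [hent] at h2
  set S := ∑ A ∈ P, Real.exp (t * g A) * W A
  set E := t * tiltedMean P g t - logMgf P g t with hE
  -- Decoupling at `θ`, with the exponential moment of `W` bounded by `hψ`; the entropy `E`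
  -- reappears on the right.
  have hS : S ≤ Z * (E / θ + (2 * R + r)) := by
    refine le_of_mul_le_mul_left (h2.trans ?_) hθp
    have : Z * logMgf P W θ ≤ Z * (θ * (2 * R + r)) := mul_le_mul_of_nonneg_left hψ hZ.le
    have e : θ * (Z * (E / θ + (2 * R + r))) = Z * E + Z * (θ * (2 * R + r)) := by field_simp
    linarith
  have h3 : E ≤ 2 * t ^ 2 * (4 / N * (3 * r + (E / θ + (2 * R + r)))) := by
    refine le_of_mul_le_mul_left (h1.trans ?_) hZ
    have := mul_le_mul_of_nonneg_left hS (show 0 ≤ 2 * t ^ 2 * (4 / N) by positivity)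
    linarith
  have h4 : E * (1 - 8 / (N * θ) * t ^ 2) ≤ t ^ 2 * q := by
    have e : 2 * t ^ 2 * (4 / N * (3 * r + (E / θ + (2 * R + r)))) =
        t ^ 2 * q + E * (8 / (N * θ) * t ^ 2) := by
      rw [hq]; field_simp; ring
    linarith
  have hct : c * t < 1 := by linarith
  -- This is `32 B ≤ 4 B ^ 2`, the place where `8 ≤ B` is needed.
  have hc2 : 8 / (N * θ) ≤ c ^ 2 := by
    have e : 8 / (N * θ) = 32 * B / N ^ 2 := by rw [hθ, hc]; field_simp; norm_num
    rw [e, hc, div_pow]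
    exact div_le_div_of_nonneg_right (by nlinarith) (by positivity)
  show E ≤ t ^ 2 * (q / (1 - c * t) ^ 2)
  rw [← mul_div_assoc, le_div_iff₀ (by positivity)]
  -- For `0 ≤ E` the point is `(1 - c t) ^ 2 ≤ 1 - (c t) ^ 2`, valid because `0 < c t < 1`.
  rcases le_total E 0 with hE0 | hE0
  · exact (mul_nonpos_of_nonpos_of_nonneg hE0 (by positivity)).trans (by positivity)
  · refine le_trans (mul_le_mul_of_nonneg_left ?_ hE0) h4
    have h5 := mul_le_mul_of_nonneg_right hc2 (sq_nonneg t)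
    have h6 : 0 < c * t := by positivity
    nlinarith

end Concentration

/-! ### RANDPERM produces a uniform subset. -/

section Law

variable {u m : ℕ}

/-- Step `k` only touches positions at or beyond `k`, so position `i` is frozen after step `i`. The
outputs are thus entries of one permutation. -/
theorem randpermArray_apply_of_lt (d : Draws u m) (i : Fin u) (k : ℕ) (hk : i.val < k) :
    randpermArray d k (Fin.castAdd m i) = randperm d i := by
  induction k with
  | zero => omega
  | succ k ih =>
    rcases Nat.lt_succ_iff_lt_or_eq.1 hk with h | h
    · rw [← ih h]
      rw [randpermArray]
      split_ifs with hku
      · rw [Equiv.Perm.mul_apply, Equiv.swap_apply_of_ne_of_ne]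
        · intro he
          have := congrArg Fin.val he
          simp at this
          omega
        · intro he
          have h1 : k ≤ (d ⟨k, hku⟩).1.val := (d ⟨k, hku⟩).2
          rw [← he, Fin.val_castAdd] at h1
          omega
      · rfl
    · subst h
      unfold randpermArray
      rw [dif_pos i.isLt]
      simp [randperm]

theorem randperm_injective (d : Draws u m) : Function.Injective (randperm d) := by
  intro i j h
  rw [← randpermArray_apply_of_lt d i u i.isLt, ← randpermArray_apply_of_lt d j u j.isLt] at h
  exact Fin.castAdd_injective u m ((randpermArray d u).injective h)

theorem randpermArray_congr (d d' : Draws u m) (k : ℕ)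
    (h : ∀ i : Fin u, i.val < k → d i = d' i) : randpermArray d k = randpermArray d' k := by
  induction k with
  | zero => rfl
  | succ k ih =>
    unfold randpermArray
    rw [ih fun i hi => h i (by omega)]
    split_ifs with hk
    · rw [h ⟨k, hk⟩ (by simp)]
    · rfl

/-- If the earlier draws agree, so do the arrays before step `i`; the injectivity of the array
recovers `d i` from its output. -/
theorem randperm_determines_draws {d d' : Draws u m} (h : randperm d = randperm d') : d = d' := by
  have key : ∀ k : ℕ, ∀ i : Fin u, i.val < k → d i = d' i := by
    intro k
    induction k with
    | zero => intro i hi; omega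
    | succ k ih =>
      intro i hi
      have hA := randpermArray_congr d d' i.val fun j hj => ih j (by omega)
      have hi' := congrFun h i
      unfold randperm at hi'
      rw [hA] at hi'
      exact Subtype.ext ((randpermArray d' i.val).injective hi')
  funext i
  exact key _ i (Nat.lt_succ_self _)

/-- The output of RANDPERM as an embedding. -/
def randpermEmbedding (d : Draws u m) : Fin u ↪ Fin (u + m) := ⟨randperm d, randperm_injective d⟩

theorem card_draws : Fintype.card (Draws u m) = (u + m).descFactorial u := by
  rw [Fintype.card_pi, Nat.descFactorial_eq_prod_range, ← Fin.prod_univ_eq_prod_range]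
  refine Finset.prod_congr rfl fun i _ => ?_
  rw [Fintype.card_subtype, Finset.filter_le_eq_Ici, Fin.card_Ici]
  simp

theorem randpermEmbedding_bijective :
    Function.Bijective (randpermEmbedding : Draws u m → (Fin u ↪ Fin (u + m))) := by
  rw [Fintype.bijective_iff_injective_and_card]
  refine ⟨fun d d' h => randperm_determines_draws (congrArg DFunLike.coe h), ?_⟩
  rw [card_draws, Fintype.card_embedding_eq, Fintype.card_fin, Fintype.card_fin]

theorem card_testSet (d : Draws u m) : (testSet d).card = u := by
  unfold testSet
  rw [Finset.card_image_of_injective _ (randperm_injective d), Finset.card_univ, Fintype.card_fin]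

theorem testSet_mem_powersetCard (d : Draws u m) :
    testSet d ∈ (Finset.univ : Finset (Fin (u + m))).powersetCard u :=
  Finset.mem_powersetCard.2 ⟨Finset.subset_univ _, card_testSet d⟩

/-- A permutation of the indices that carries `A` to `B` acts on embeddings by composition. -/
theorem card_embedding_image_eq (A B : Finset (Fin (u + m))) (h : A.card = B.card) :
    (Finset.univ.filter fun e : Fin u ↪ Fin (u + m) => Finset.univ.map e = A).card =
      (Finset.univ.filter fun e : Fin u ↪ Fin (u + m) => Finset.univ.map e = B).card := by
  obtain ⟨π, hπ⟩ : ∃ π : Equiv.Perm (Fin (u + m)), A.map π.toEmbedding = B := by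
    let e : A ≃ B := Finset.equivOfCardEq h
    refine ⟨e.extendSubtype, ?_⟩
    apply Finset.eq_of_subset_of_card_le
    · intro x hx
      obtain ⟨y, hy, rfl⟩ := Finset.mem_map.1 hx
      exact e.extendSubtype_mem y hy
    · rw [Finset.card_map, h]
  subst hπ
  refine Finset.card_bij' (fun e _ => e.trans π.toEmbedding)
    (fun e _ => e.trans π.symm.toEmbedding) ?_ ?_ ?_ ?_
  · intro e he
    rw [Finset.mem_filter] at he ⊢
    exact ⟨Finset.mem_univ _, by rw [← Finset.map_map, he.2]⟩
  · intro e he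
    rw [Finset.mem_filter] at he ⊢
    refine ⟨Finset.mem_univ _, ?_⟩
    rw [← Finset.map_map, he.2, Finset.map_map]
    simp
  · intro e _; ext; simp
  · intro e _; ext; simp

theorem card_testSet_fiber (A B : Finset (Fin (u + m))) (h : A.card = B.card) :
    (Finset.univ.filter fun d : Draws u m => testSet d = A).card =
      (Finset.univ.filter fun d : Draws u m => testSet d = B).card := by
  have key : ∀ C : Finset (Fin (u + m)),
      (Finset.univ.filter fun d : Draws u m => testSet d = C).card =
      (Finset.univ.filter fun e : Fin u ↪ Fin (u + m) => Finset.univ.map e = C).card := by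
    intro C
    refine Finset.card_bijective _ randpermEmbedding_bijective fun d => ?_
    simp only [Finset.mem_filter, Finset.mem_univ, true_and, Finset.map_eq_image]
    rfl
  rw [key, key, card_embedding_image_eq A B h]

theorem drawLaw_real_singleton (d : Draws u m) :
    (drawLaw u m).real {d} = 1 / (Fintype.card (Draws u m) : ℝ) := by
  unfold drawLaw
  rw [measureReal_def, Measure.pi_singleton, ENNReal.toReal_prod, Fintype.card_pi, Nat.cast_prod,
    one_div, ← Finset.prod_inv_distrib]
  refine Finset.prod_congr rfl fun i _ => ?_
  rw [PMF.toMeasure_apply_singleton _ _ (measurableSet_singleton _),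
    PMF.uniformOfFintype_apply]
  simp

/-- The test set is uniformly distributed among the sets of `u` indices. -/
theorem integral_testSet (f : Finset (Fin (u + m)) → ℝ) :
    ∫ d, f (testSet d) ∂(drawLaw u m) =
      (∑ A ∈ (Finset.univ : Finset (Fin (u + m))).powersetCard u, f A) /
        (((Finset.univ : Finset (Fin (u + m))).powersetCard u).card : ℝ) := by
  set P := (Finset.univ : Finset (Fin (u + m))).powersetCard u with hP
  obtain ⟨d₀⟩ : Nonempty (Draws u m) := inferInstance
  set c := (Finset.univ.filter fun d : Draws u m => testSet d = testSet d₀).card with hc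
  have hfib : ∀ A ∈ P, (Finset.univ.filter fun d : Draws u m => testSet d = A).card = c := by
    intro A hA
    exact card_testSet_fiber _ _ (by rw [card_testSet, (Finset.mem_powersetCard.1 hA).2])
  have hmaps : ∀ d ∈ (Finset.univ : Finset (Draws u m)), testSet d ∈ P :=
    fun d _ => testSet_mem_powersetCard d
  have hcard : Fintype.card (Draws u m) = P.card * c := by
    rw [← Finset.card_univ, Finset.card_eq_sum_card_fiberwise hmaps, Finset.sum_congr rfl hfib,
      Finset.sum_const, smul_eq_mul]
  have hsum : ∑ d : Draws u m, f (testSet d) = c * ∑ A ∈ P, f A := by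
    rw [← Finset.sum_fiberwise_of_maps_to hmaps, Finset.mul_sum]
    refine Finset.sum_congr rfl fun A hA => ?_
    rw [← hfib A hA, ← nsmul_eq_mul, ← Finset.sum_const]
    exact Finset.sum_congr rfl fun d hd => by rw [(Finset.mem_filter.1 hd).2]
  have hc0 : (c : ℝ) ≠ 0 := by
    have : 0 < c := Finset.card_pos.2 ⟨d₀, Finset.mem_filter.2 ⟨Finset.mem_univ _, rfl⟩⟩
    exact_mod_cast this.ne'
  have hP0 : (P.card : ℝ) ≠ 0 := by
    have : 0 < P.card := Finset.card_pos.2 ⟨_, testSet_mem_powersetCard d₀⟩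
    exact_mod_cast this.ne'
  rw [integral_fintype (Integrable.of_finite)]
  simp only [drawLaw_real_singleton, smul_eq_mul]
  rw [← Finset.mul_sum, hsum, hcard]
  push_cast
  field_simp

/-- The probability of an event on the test set, as a proportion of sets of `u` indices. -/
theorem drawLaw_real_testSet (p : Finset (Fin (u + m)) → Prop) [DecidablePred p] :
    (drawLaw u m).real {d | p (testSet d)} =
      ((((Finset.univ : Finset (Fin (u + m))).powersetCard u).filter p).card : ℝ) /
        (((Finset.univ : Finset (Fin (u + m))).powersetCard u).card : ℝ) := by
  have h := integral_testSet (u := u) (m := m) (fun A => if p A then 1 else 0)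
  rw [Finset.sum_boole] at h
  rw [← h, ← integral_indicator_one (Set.Finite.measurableSet (Set.toFinite _))]
  refine integral_congr_ae (Filter.Eventually.of_forall fun d => ?_)
  simp [Set.indicator_apply]

end Law

/-! ### Suprema over bounded classes. -/

section Supremum

variable {κ ι : Type*}

theorem isCompact_closure_range {φ : κ → ι → ℝ} {C : ℝ} (hφ : ∀ k i, |φ k i| ≤ C) :
    IsCompact (closure (Set.range φ)) := by
  refine IsCompact.closure_of_subset
    (isCompact_univ_pi fun _ : ι => isCompact_Icc (a := -C) (b := C)) ?_
  rintro _ ⟨k, rfl⟩ i _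
  exact abs_le.1 (hφ k i)

theorem bddAbove_range_comp {φ : κ → ι → ℝ} {C : ℝ} (hφ : ∀ k i, |φ k i| ≤ C)
    {f : (ι → ℝ) → ℝ} (hf : Continuous f) : BddAbove (Set.range fun k => f (φ k)) := by
  refine ((isCompact_closure_range hφ).image hf).bddAbove.mono ?_
  rintro _ ⟨k, rfl⟩
  exact ⟨φ k, subset_closure ⟨k, rfl⟩, rfl⟩

theorem le_iSup_of_mem_closure_range {φ : κ → ι → ℝ} {C : ℝ} (hφ : ∀ k i, |φ k i| ≤ C)
    {f : (ι → ℝ) → ℝ} (hf : Continuous f) {v : ι → ℝ} (hv : v ∈ closure (Set.range φ)) :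
    f v ≤ ⨆ k, f (φ k) :=
  closure_minimal (t := {v | f v ≤ ⨆ k, f (φ k)})
    (Set.range_subset_iff.2 fun k => le_ciSup (bddAbove_range_comp hφ hf) k)
    (isClosed_le hf continuous_const) hv

/-- The supremum need not be attained in the class, but the loss vectors lie in a compact cube, so
it is attained on their closure. -/
theorem exists_mem_closure_range_eq_iSup [Nonempty κ] {φ : κ → ι → ℝ} {C : ℝ}
    (hφ : ∀ k i, |φ k i| ≤ C)
    {f : (ι → ℝ) → ℝ} (hf : Continuous f) :
    ∃ v ∈ closure (Set.range φ), f v = ⨆ k, f (φ k) := by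
  obtain ⟨v, hv, hmax⟩ := (isCompact_closure_range hφ).exists_isMaxOn
    ((Set.range_nonempty φ).closure) hf.continuousOn
  exact ⟨v, hv, le_antisymm (le_iSup_of_mem_closure_range hφ hf hv)
    (ciSup_le fun k => hmax (subset_closure ⟨k, rfl⟩))⟩

end Supremum

theorem sq_max_zero_le {a b : ℝ} (h : a ≤ b) : (max a 0) ^ 2 ≤ b ^ 2 := by
  rcases le_total a 0 with ha | ha
  · rw [max_eq_right ha, zero_pow two_ne_zero]; positivity
  · rw [max_eq_left ha]; exact pow_le_pow_left₀ ha h 2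

theorem sum_exchange {ι : Type*} [DecidableEq ι] {A : Finset ι} {i j : ι} (hi : i ∈ A)
    (hj : j ∉ A) (w : ι → ℝ) : ∑ x ∈ exchange A i j, w x = ∑ x ∈ A, w x - w i + w j := by
  unfold exchange
  rw [Finset.sum_insert fun h => hj (Finset.mem_of_mem_erase h), ← Finset.sum_erase_add _ _ hi]
  ring

/-! ### Variance proxies for vectors of losses. -/

section TestTrainVectors

variable {u m : ℕ}

/-- The test-train gap of a vector of losses, as a function of the test set. -/
noncomputable def testTrainGap (A : Finset (Fin (u + m))) (v : Fin (u + m) → ℝ) : ℝ :=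
  1 / (u : ℝ) * ∑ i ∈ A, v i - 1 / (m : ℝ) * ∑ i ∈ Aᶜ, v i

/-- The mean of a vector of losses over the smaller one of the test set and the training set. -/
noncomputable def smallPartMean (A : Finset (Fin (u + m))) (v : Fin (u + m) → ℝ) : ℝ :=
  if u ≤ m then 1 / (u : ℝ) * ∑ i ∈ A, v i else 1 / (m : ℝ) * ∑ i ∈ Aᶜ, v i

/-- The mean of a vector of losses over the full sample. -/
noncomputable def fullMean (v : Fin (u + m) → ℝ) : ℝ := 1 / ((u + m : ℕ) : ℝ) * ∑ i, v i

theorem continuous_testTrainGap (A : Finset (Fin (u + m))) :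
    Continuous (testTrainGap A) := by
  unfold testTrainGap; fun_prop

theorem continuous_fullMean : Continuous (fullMean : (Fin (u + m) → ℝ) → ℝ) := by
  unfold fullMean; fun_prop

theorem continuous_smallPartMean_sub (A : Finset (Fin (u + m))) :
    Continuous fun v => smallPartMean A v - fullMean v := by
  refine Continuous.sub ?_ continuous_fullMean
  unfold smallPartMean
  split_ifs <;> fun_prop

theorem sum_compl_eq (A : Finset (Fin (u + m))) (v : Fin (u + m) → ℝ) :
    ∑ i ∈ Aᶜ, v i = ∑ i, v i - ∑ i ∈ A, v i := by
  rw [← Finset.sum_add_sum_compl A v]; ring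

theorem testTrainGap_sub_exchange {A : Finset (Fin (u + m))} {i j : Fin (u + m)} (hi : i ∈ A)
    (hj : j ∉ A) (v : Fin (u + m) → ℝ) :
    testTrainGap A v - testTrainGap (exchange A i j) v =
      (1 / (u : ℝ) + 1 / (m : ℝ)) * (v i - v j) := by
  unfold testTrainGap
  rw [sum_compl_eq, sum_compl_eq, sum_exchange hi hj]
  ring

theorem smallPartMean_sub_exchange {A : Finset (Fin (u + m))} {i j : Fin (u + m)} (hi : i ∈ A)
    (hj : j ∉ A) (v : Fin (u + m) → ℝ) :
    smallPartMean A v - smallPartMean (exchange A i j) v =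
      if u ≤ m then 1 / (u : ℝ) * (v i - v j) else 1 / (m : ℝ) * (v j - v i) := by
  unfold smallPartMean
  split_ifs
  · rw [sum_exchange hi hj]; ring
  · rw [sum_compl_eq, sum_compl_eq, sum_exchange hi hj]; ring

theorem sum_sum_left (A : Finset (Fin (u + m))) (hA : A.card = u) (f : Fin (u + m) → ℝ) :
    ∑ i ∈ A, ∑ _j ∈ Finset.univ \ A, f i = m * ∑ i ∈ A, f i := by
  have hc : (Finset.univ \ A).card = m := by
    rw [Finset.card_sdiff_of_subset (Finset.subset_univ A), hA, Finset.card_univ, Fintype.card_fin]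
    omega
  rw [Finset.mul_sum]
  exact Finset.sum_congr rfl fun i _ => by rw [Finset.sum_const, hc, nsmul_eq_mul]

theorem sum_sum_right (A : Finset (Fin (u + m))) (hA : A.card = u) (f : Fin (u + m) → ℝ) :
    ∑ _i ∈ A, ∑ j ∈ Finset.univ \ A, f j = u * ∑ j ∈ Aᶜ, f j := by
  rw [Finset.sum_const, hA, nsmul_eq_mul, Finset.compl_eq_univ_sdiff]

theorem fullMean_eq (A : Finset (Fin (u + m))) (v : Fin (u + m) → ℝ) (hu : 0 < u) :
    ((u : ℝ) + m) * fullMean v = ∑ i ∈ A, v i + ∑ i ∈ Aᶜ, v i := by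
  have : (0 : ℝ) < u := by exact_mod_cast hu
  unfold fullMean
  rw [Finset.sum_add_sum_compl]
  push_cast
  field_simp

/-- The mean of a nonnegative vector over both parts, in terms of the smaller part. -/
theorem add_mean_le (hu : 0 < u) (hm : 0 < m) (A : Finset (Fin (u + m))) (v : Fin (u + m) → ℝ)
    (hv : ∀ i, 0 ≤ v i) {r w : ℝ} (hr : fullMean v ≤ r) (hw : smallPartMean A v - fullMean v ≤ w) :
    1 / (u : ℝ) * ∑ i ∈ A, v i + 1 / (m : ℝ) * ∑ i ∈ Aᶜ, v i ≤ 3 * r + w := by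
  have hu' : (0 : ℝ) < u := by exact_mod_cast hu
  have hm' : (0 : ℝ) < m := by exact_mod_cast hm
  have hfull := fullMean_eq A v hu
  have h1 : 0 ≤ ∑ i ∈ A, v i := Finset.sum_nonneg fun i _ => hv i
  have h2 : 0 ≤ ∑ i ∈ Aᶜ, v i := Finset.sum_nonneg fun i _ => hv i
  have h0 : 0 ≤ fullMean v := by
    have : 0 ≤ ((u : ℝ) + m) * fullMean v := by rw [hfull]; positivity
    exact nonneg_of_mul_nonneg_right this (by positivity)
  unfold smallPartMean at hw
  split_ifs at hw with h
  · have h' : (u : ℝ) ≤ m := by exact_mod_cast h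
    -- The larger part has at least half of the indices, so its mean is at most twice the full mean.
    have : 1 / (m : ℝ) * ∑ i ∈ Aᶜ, v i ≤ 2 * fullMean v := by
      rw [one_div, inv_mul_le_iff₀ hm']
      nlinarith
    linarith
  · have h' : (m : ℝ) ≤ u := by exact_mod_cast (le_of_not_ge h)
    have : 1 / (u : ℝ) * ∑ i ∈ A, v i ≤ 2 * fullMean v := by
      rw [one_div, inv_mul_le_iff₀ hu']
      nlinarith
    linarith

theorem one_div_add_one_div_le (hu : 0 < u) (hm : 0 < m) :
    1 / (u : ℝ) + 1 / (m : ℝ) ≤ 2 / ((min u m : ℕ) : ℝ) := by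
  have hN : (0 : ℝ) < ((min u m : ℕ) : ℝ) := by exact_mod_cast lt_min hu hm
  have h1 : 1 / (u : ℝ) ≤ 1 / ((min u m : ℕ) : ℝ) :=
    one_div_le_one_div_of_le hN (by exact_mod_cast min_le_left u m)
  have h2 : 1 / (m : ℝ) ≤ 1 / ((min u m : ℕ) : ℝ) :=
    one_div_le_one_div_of_le hN (by exact_mod_cast min_le_right u m)
  have : 2 / ((min u m : ℕ) : ℝ) = 1 / ((min u m : ℕ) : ℝ) + 1 / ((min u m : ℕ) : ℝ) := by ring
  linarith

/-- Uses `(a - b) ^ 2 ≤ 2 a ^ 2 + 2 b ^ 2`, then `(1 / u + 1 / m) u m = u + m`, so that one factor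
`1 / u + 1 / m ≤ 2 / min u m` remains in front of the two means. -/
theorem sum_sq_testTrainGap_le (hu : 0 < u) (hm : 0 < m) {A : Finset (Fin (u + m))}
    (hA : A.card = u) (v : Fin (u + m) → ℝ) {r w : ℝ} (hr : fullMean (v ^ 2) ≤ r)
    (hw : smallPartMean A (v ^ 2) - fullMean (v ^ 2) ≤ w) :
    ∑ i ∈ A, ∑ j ∈ Finset.univ \ A, ((1 / (u : ℝ) + 1 / (m : ℝ)) * (v i - v j)) ^ 2 ≤
      ((u + m : ℕ) : ℝ) * (4 / ((min u m : ℕ) : ℝ) * (3 * r + w)) := by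
  have hu' : (0 : ℝ) < u := by exact_mod_cast hu
  have hm' : (0 : ℝ) < m := by exact_mod_cast hm
  have hN : (0 : ℝ) < ((min u m : ℕ) : ℝ) := by exact_mod_cast lt_min hu hm
  set c := 1 / (u : ℝ) + 1 / (m : ℝ) with hc
  have hcp : 0 < c := by positivity
  have hsum : ∑ i ∈ A, ∑ j ∈ Finset.univ \ A, (c * (v i - v j)) ^ 2 ≤
      2 * c ^ 2 * (m * ∑ i ∈ A, (v ^ 2) i + u * ∑ j ∈ Aᶜ, (v ^ 2) j) := by
    rw [← sum_sum_left A hA, ← sum_sum_right A hA, ← Finset.sum_add_distrib, Finset.mul_sum]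
    refine Finset.sum_le_sum fun i _ => ?_
    rw [← Finset.sum_add_distrib, Finset.mul_sum]
    refine Finset.sum_le_sum fun j _ => ?_
    have := mul_nonneg (sq_nonneg c) (sq_nonneg (v i + v j))
    simp only [Pi.pow_apply]
    nlinarith
  have hmean := add_mean_le hu hm A (v ^ 2) (fun i => by simp only [Pi.pow_apply]; positivity) hr hw
  have hmean0 : 0 ≤ 1 / (u : ℝ) * ∑ i ∈ A, (v ^ 2) i + 1 / (m : ℝ) * ∑ i ∈ Aᶜ, (v ^ 2) i := by
    have h1 : 0 ≤ ∑ i ∈ A, (v ^ 2) i :=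
      Finset.sum_nonneg fun i _ => by simp only [Pi.pow_apply]; positivity
    have h2 : 0 ≤ ∑ i ∈ Aᶜ, (v ^ 2) i :=
      Finset.sum_nonneg fun i _ => by simp only [Pi.pow_apply]; positivity
    positivity
  refine hsum.trans ?_
  have e : 2 * c ^ 2 * (m * ∑ i ∈ A, (v ^ 2) i + u * ∑ j ∈ Aᶜ, (v ^ 2) j) =
      ((u : ℝ) + m) * (2 * c *
        (1 / (u : ℝ) * ∑ i ∈ A, (v ^ 2) i + 1 / (m : ℝ) * ∑ i ∈ Aᶜ, (v ^ 2) i)) := by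
    rw [hc]; field_simp; ring
  rw [e]
  push_cast
  refine mul_le_mul_of_nonneg_left ?_ (by positivity)
  have hcN := one_div_add_one_div_le hu hm
  push_cast at hcN
  refine mul_le_mul ?_ hmean hmean0 (by positivity)
  have : 4 / min (u : ℝ) m = 2 * (2 / min (u : ℝ) m) := by ring
  rw [this]
  exact mul_le_mul_of_nonneg_left hcN (by norm_num)

/-- Since `v` is nonnegative, a positive decrement is at most the term that leaves the smaller part.
Then `v i ^ 2 ≤ B * v i` returns the square to the mean itself, which is what makes it
self-bounding. -/
theorem sum_sq_smallPartMean_le (hu : 0 < u) (hm : 0 < m) {A : Finset (Fin (u + m))}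
    (hA : A.card = u) (v : Fin (u + m) → ℝ) {B r w : ℝ} (hv : ∀ i, 0 ≤ v i) (hvB : ∀ i, v i ≤ B)
    (hr : fullMean v ≤ r) (hw : smallPartMean A v - fullMean v = w) :
    ∑ i ∈ A, ∑ j ∈ Finset.univ \ A,
        (max (if u ≤ m then 1 / (u : ℝ) * (v i - v j) else 1 / (m : ℝ) * (v j - v i)) 0) ^ 2 ≤
      ((u + m : ℕ) : ℝ) * (B / ((min u m : ℕ) : ℝ) * (r + w)) := by
  have hu' : (0 : ℝ) < u := by exact_mod_cast hu
  have hm' : (0 : ℝ) < m := by exact_mod_cast hm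
  have hB : 0 ≤ B := (hv ⟨0, by omega⟩).trans (hvB _)
  have hsq : ∀ C : Finset (Fin (u + m)), ∑ i ∈ C, v i ^ 2 ≤ B * ∑ i ∈ C, v i := by
    intro C
    rw [Finset.mul_sum]
    refine Finset.sum_le_sum fun i _ => ?_
    rw [sq]
    exact mul_le_mul_of_nonneg_right (hvB i) (hv i)
  have hnn : ∀ C : Finset (Fin (u + m)), 0 ≤ ∑ i ∈ C, v i :=
    fun C => Finset.sum_nonneg fun i _ => hv i
  unfold smallPartMean at hw
  split_ifs at hw with h
  · simp only [if_pos h, min_eq_left h]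
    have hle : ∑ i ∈ A, ∑ j ∈ Finset.univ \ A, (max (1 / (u : ℝ) * (v i - v j)) 0) ^ 2 ≤
        ∑ i ∈ A, ∑ _j ∈ Finset.univ \ A, (1 / (u : ℝ) * v i) ^ 2 :=
      Finset.sum_le_sum fun i _ => Finset.sum_le_sum fun j _ => sq_max_zero_le
        (mul_le_mul_of_nonneg_left (by linarith [hv j]) (by positivity))
    refine hle.trans ?_
    rw [sum_sum_left A hA fun i => (1 / (u : ℝ) * v i) ^ 2]
    simp only [mul_pow, ← Finset.mul_sum]
    have h1 : 1 / (u : ℝ) * ∑ i ∈ A, v i ≤ r + w := by linarith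
    have h2 : 0 ≤ 1 / (u : ℝ) * ∑ i ∈ A, v i := mul_nonneg (by positivity) (hnn A)
    calc (m : ℝ) * ((1 / (u : ℝ)) ^ 2 * ∑ i ∈ A, v i ^ 2)
        ≤ (m : ℝ) * ((1 / (u : ℝ)) ^ 2 * (B * ∑ i ∈ A, v i)) := by gcongr; exact hsq A
      _ = m * (B / u * (1 / (u : ℝ) * ∑ i ∈ A, v i)) := by field_simp
      _ ≤ ((u + m : ℕ) : ℝ) * (B / u * (r + w)) := by
        push_cast
        gcongr
        linarith
  · have h' : m ≤ u := le_of_not_ge h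
    simp only [if_neg h, min_eq_right h']
    have hle : ∑ i ∈ A, ∑ j ∈ Finset.univ \ A, (max (1 / (m : ℝ) * (v j - v i)) 0) ^ 2 ≤
        ∑ _i ∈ A, ∑ j ∈ Finset.univ \ A, (1 / (m : ℝ) * v j) ^ 2 :=
      Finset.sum_le_sum fun i _ => Finset.sum_le_sum fun j _ => sq_max_zero_le
        (mul_le_mul_of_nonneg_left (by linarith [hv i]) (by positivity))
    refine hle.trans ?_
    rw [sum_sum_right A hA fun i => (1 / (m : ℝ) * v i) ^ 2]
    simp only [mul_pow, ← Finset.mul_sum]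
    have h1 : 1 / (m : ℝ) * ∑ i ∈ Aᶜ, v i ≤ r + w := by linarith
    have h2 : 0 ≤ 1 / (m : ℝ) * ∑ i ∈ Aᶜ, v i := mul_nonneg (by positivity) (hnn Aᶜ)
    calc (u : ℝ) * ((1 / (m : ℝ)) ^ 2 * ∑ i ∈ Aᶜ, v i ^ 2)
        ≤ (u : ℝ) * ((1 / (m : ℝ)) ^ 2 * (B * ∑ i ∈ Aᶜ, v i)) := by gcongr; exact hsq Aᶜ
      _ = u * (B / m * (1 / (m : ℝ) * ∑ i ∈ Aᶜ, v i)) := by field_simp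
      _ ≤ ((u + m : ℕ) : ℝ) * (B / m * (r + w)) := by
        push_cast
        gcongr
        linarith

/-- A uniform `u`-subset contains each index with probability `u / (u + m)`. -/
theorem sum_powersetCard_sum (hu : 0 < u) (v : Fin (u + m) → ℝ) :
    ∑ A ∈ (Finset.univ : Finset (Fin (u + m))).powersetCard u, ∑ i ∈ A, v i =
      (((Finset.univ : Finset (Fin (u + m))).powersetCard u).card : ℝ) * (u * fullMean v) := by
  have hu' : (0 : ℝ) < u := by exact_mod_cast hu
  obtain ⟨k, hk⟩ : ∃ k, u = k + 1 := ⟨u - 1, by omega⟩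
  have hcount : ∀ i : Fin (u + m), ∑ A ∈ (Finset.univ : Finset (Fin (u + m))).powersetCard u,
      (if i ∈ A then (1 : ℝ) else 0) = ((u + m - 1).choose k : ℝ) := by
    intro i
    have h := sum_powersetCard_succ_erase (Finset.mem_univ i) k
      (fun A => if i ∈ A then (1 : ℝ) else 0)
    rw [← hk] at h
    rw [h, Finset.sum_congr rfl fun A _ => if_pos (Finset.mem_insert_self i A),
      Finset.sum_eq_zero fun A hA => if_neg fun hi =>
        Finset.notMem_erase i _ ((Finset.mem_powersetCard.1 hA).1 hi)]
    simp
  have hsum : ∑ A ∈ (Finset.univ : Finset (Fin (u + m))).powersetCard u, ∑ i ∈ A, v i =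
      ((u + m - 1).choose k : ℝ) * ∑ i, v i := by
    have h1 : ∀ A ∈ (Finset.univ : Finset (Fin (u + m))).powersetCard u, ∑ i ∈ A, v i =
        ∑ i, (if i ∈ A then (1 : ℝ) else 0) * v i := by
      intro A _
      simp [Finset.sum_ite_mem]
    rw [Finset.sum_congr rfl h1, Finset.sum_comm, Finset.mul_sum]
    exact Finset.sum_congr rfl fun i _ => by rw [← Finset.sum_mul, hcount]
  have hch : ((u : ℝ) + m) * ((u + m - 1).choose k : ℝ) = ((u + m).choose u : ℝ) * u := by
    have := Nat.add_one_mul_choose_eq (u + m - 1) k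
    rw [Nat.sub_add_cancel (by omega), ← hk] at this
    exact_mod_cast this
  rw [hsum, Finset.card_powersetCard, Finset.card_univ, Fintype.card_fin, fullMean]
  push_cast
  field_simp
  linear_combination (∑ i, v i) * hch

/-- Each fixed vector is centered, so the complexity, the mean of a supremum of such terms, is
nonnegative. -/
theorem sum_smallPartMean_sub_fullMean (hu : 0 < u) (hm : 0 < m) (v : Fin (u + m) → ℝ) :
    ∑ A ∈ (Finset.univ : Finset (Fin (u + m))).powersetCard u,
      (smallPartMean A v - fullMean v) = 0 := by
  have hu' : (0 : ℝ) < u := by exact_mod_cast hu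
  have hm' : (0 : ℝ) < m := by exact_mod_cast hm
  have h := sum_powersetCard_sum (m := m) hu v
  have hn : ∑ i, v i = ((u : ℝ) + m) * fullMean v := by
    rw [fullMean_eq ∅ v hu]; simp
  rw [Finset.sum_sub_distrib, Finset.sum_const, nsmul_eq_mul]
  unfold smallPartMean
  split_ifs
  · rw [← Finset.mul_sum, h]; field_simp; ring
  · simp only [sum_compl_eq]
    rw [← Finset.mul_sum, Finset.sum_sub_distrib, h, Finset.sum_const, nsmul_eq_mul, hn]
    field_simp
    ring

end TestTrainVectors

/-! ### Numerical form of the deviation and conclusion. -/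

theorem deviation_le {r R N x B E : ℝ} (hr : 0 < r) (hR : 0 ≤ R) (hN : 0 < N) (hx : 0 < x)
    (hB : 0 ≤ B) :
    E + 2 * Real.sqrt (8 * (4 * r + 2 * R) / N * x) + 2 * B / N * x ≤
      E + 8 * Real.sqrt (3 * r * x / N) +
        (⨅ α : Set.Ioi (0 : ℝ), (4 * R / α.1 + 4 * α.1 * x / N)) + 8 * B * x / N := by
  have h1 : Real.sqrt (8 * (4 * r + 2 * R) / N * x) ≤
      4 * Real.sqrt (3 * r * x / N) + 4 * Real.sqrt (R * x / N) := by
    apply Real.sqrt_le_iff.2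
    refine ⟨by positivity, ?_⟩
    have e1 := Real.sq_sqrt (show 0 ≤ 3 * r * x / N by positivity)
    have e2 := Real.sq_sqrt (show 0 ≤ R * x / N by positivity)
    have e3 : 0 ≤ Real.sqrt (3 * r * x / N) * Real.sqrt (R * x / N) := by positivity
    -- The constant `3 r` is generous: `32 r` is bounded by `48 r`.
    have e4 : 8 * (4 * r + 2 * R) / N * x =
        16 * (3 * r * x / N) + 16 * (R * x / N) - 16 * (r * x / N) := by ring
    have e5 : 0 ≤ r * x / N := by positivity
    nlinarith
  have h2 : 8 * Real.sqrt (R * x / N) ≤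
      ⨅ α : Set.Ioi (0 : ℝ), (4 * R / α.1 + 4 * α.1 * x / N) := by
    have : Nonempty (Set.Ioi (0 : ℝ)) := ⟨⟨1, by simp⟩⟩
    refine le_ciInf fun α => ?_
    have hα : 0 < α.1 := α.2
    have e : R * x / N = (R / α.1) * (α.1 * x / N) := by field_simp
    rw [e, Real.sqrt_mul (by positivity)]
    have e1 := Real.sq_sqrt (show 0 ≤ R / α.1 by positivity)
    have e2 := Real.sq_sqrt (show 0 ≤ α.1 * x / N by positivity)
    have e3 := sq_nonneg (Real.sqrt (R / α.1) - Real.sqrt (α.1 * x / N))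
    -- AM-GM for `R / α` and `α x / N`, for each `α`.
    have e4 : 4 * R / α.1 + 4 * α.1 * x / N = 4 * (R / α.1) + 4 * (α.1 * x / N) := by ring
    rw [e4]
    nlinarith
  have h3 : 2 * B / N * x ≤ 8 * B * x / N := by
    have e : 8 * B * x / N = 2 * B / N * x + 6 * (B * x / N) := by ring
    have : 0 ≤ B * x / N := by positivity
    linarith
  linarith

theorem mainTheorem2 {𝒳 𝒴 : Type*} (u m : ℕ) (hu : 0 < u) (hm : 0 < m)
    (S : Fin (u + m) → 𝒳 × 𝒴)
    (H : Set (𝒳 × 𝒴 → ℝ)) (hH : H.Nonempty)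
    (H₀ : ℝ) (hH₀ : 2 * Real.sqrt 2 ≤ H₀)
    (hbound : ∀ h ∈ H, ∀ i, |h (S i)| ≤ H₀)
    (r : ℝ) (hr : 0 < r) (hT : ∀ h ∈ H, avgSqLoss S h ≤ r)
    (x : ℝ) (hx : 0 < x) :
    1 - Real.exp (-x) ≤ (drawLaw u m).real
      {d | testTrain S H d ≤
        (∫ d', testTrain S H d' ∂(drawLaw u m))
          + 8 * Real.sqrt (3 * r * x / ((min u m : ℕ) : ℝ))
          + (⨅ α : Set.Ioi (0 : ℝ),
              (4 * transComplexityMin S (sqClass H) / α.1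
                + 4 * α.1 * x / ((min u m : ℕ) : ℝ)))
          + 8 * H₀ ^ 2 * x / ((min u m : ℕ) : ℝ)} := by
  classical
  have hN : (0 : ℝ) < ((min u m : ℕ) : ℝ) := by exact_mod_cast lt_min hu hm
  -- The assumption `2√2 ≤ H₀` serves only to supply `8 ≤ B` for the concentration bound with `B =
  -- H₀ ^ 2`.
  have hB : 8 ≤ H₀ ^ 2 := by
    have h := pow_le_pow_left₀ (by positivity) hH₀ 2
    rw [mul_pow, Real.sq_sqrt (by norm_num)] at h
    linarith
  have : Nonempty H := hH.to_subtype
  have : Nonempty (sqClass H) := (hH.image _).to_subtype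
  set φ : H → Fin (u + m) → ℝ := fun h i => h.1 (S i) with hφ
  set φ₁ : sqClass H → Fin (u + m) → ℝ := fun h i => h.1 (S i) with hφ₁
  have hφb : ∀ h i, |φ h i| ≤ H₀ := fun h i => hbound h.1 h.2 i
  have hφ₁nn : ∀ h i, 0 ≤ φ₁ h i := by
    rintro ⟨_, h, hh, rfl⟩ i
    exact sq_nonneg (h (S i))
  have hφ₁le : ∀ h i, φ₁ h i ≤ H₀ ^ 2 := by
    rintro ⟨_, h, hh, rfl⟩ i
    exact sq_le_sq' (abs_le.1 (hbound h hh i)).1 (abs_le.1 (hbound h hh i)).2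
  have hφ₁b : ∀ h i, |φ₁ h i| ≤ H₀ ^ 2 := fun h i => by
    rw [abs_of_nonneg (hφ₁nn h i)]; exact hφ₁le h i
  have hφ₁r : ∀ h, fullMean (φ₁ h) ≤ r := by
    rintro ⟨_, h, hh, rfl⟩
    exact hT h hh
  set P := (Finset.univ : Finset (Fin (u + m))).powersetCard u with hP
  set g : Finset (Fin (u + m)) → ℝ := fun A => ⨆ h, testTrainGap A (φ h) with hg
  set W : Finset (Fin (u + m)) → ℝ := fun A =>
    ⨆ h, (smallPartMean A (φ₁ h) - fullMean (φ₁ h)) with hW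
  have hcard : (Finset.univ : Finset (Fin (u + m))).card = u + m := by simp
  have hclr : ∀ w ∈ closure (Set.range φ₁), fullMean w ≤ r := fun w hw =>
    closure_minimal (t := {w | fullMean w ≤ r}) (Set.range_subset_iff.2 hφ₁r)
      (isClosed_le continuous_fullMean continuous_const) hw
  have hgV : ∀ A ∈ P, ∑ i ∈ A, ∑ j ∈ Finset.univ \ A, (max (g A - g (exchange A i j)) 0) ^ 2 ≤
      ((Finset.univ : Finset (Fin (u + m))).card : ℝ) *
        (4 / ((min u m : ℕ) : ℝ) * (3 * r + W A)) := by
    intro A hA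
    -- A maximizer `v` at `A` is kept after the exchange, where it is still a competitor; hence the
    -- decrement of `g` is at most that of the gap of `v`. Its square lies in the closure of the
    -- squared class, so `W A` controls it.
    obtain ⟨v, hv, hvA⟩ := exists_mem_closure_range_eq_iSup hφb (continuous_testTrainGap A)
    have hv2 : v ^ 2 ∈ closure (Set.range φ₁) := by
      refine map_mem_closure (f := fun v : Fin (u + m) → ℝ => v ^ 2) (by fun_prop) hv ?_
      rintro _ ⟨h, rfl⟩
      exact ⟨⟨h.1 ^ 2, h.1, h.2, rfl⟩, rfl⟩
    rw [hcard]
    refine le_trans (Finset.sum_le_sum fun i hi => Finset.sum_le_sum fun j hj => ?_)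
      (sum_sq_testTrainGap_le hu hm (Finset.mem_powersetCard.1 hA).2 v (hclr _ hv2)
        (le_iSup_of_mem_closure_range hφ₁b (continuous_smallPartMean_sub A) hv2))
    refine sq_max_zero_le ?_
    rw [← testTrainGap_sub_exchange hi (Finset.mem_sdiff.1 hj).2 v, hvA]
    exact sub_le_sub_left (le_iSup_of_mem_closure_range hφb (continuous_testTrainGap _) hv) _
  have hWV : ∀ A ∈ P, ∑ i ∈ A, ∑ j ∈ Finset.univ \ A, (max (W A - W (exchange A i j)) 0) ^ 2 ≤
      ((Finset.univ : Finset (Fin (u + m))).card : ℝ) *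
        (H₀ ^ 2 / ((min u m : ℕ) : ℝ) * (r + W A)) := by
    intro A hA
    obtain ⟨w, hw, hwA⟩ := exists_mem_closure_range_eq_iSup hφ₁b (continuous_smallPartMean_sub A)
    have hnn : ∀ i, 0 ≤ w i := fun i => by
      have := closure_minimal (t := {w : Fin (u + m) → ℝ | 0 ≤ w i})
        (Set.range_subset_iff.2 fun h => hφ₁nn h i)
        (isClosed_le continuous_const (continuous_apply i))
      exact this hw
    have hle : ∀ i, w i ≤ H₀ ^ 2 := fun i => by
      have := closure_minimal (t := {w : Fin (u + m) → ℝ | w i ≤ H₀ ^ 2})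
        (Set.range_subset_iff.2 fun h => hφ₁le h i)
        (isClosed_le (continuous_apply i) continuous_const)
      exact this hw
    rw [hcard]
    refine le_trans (Finset.sum_le_sum fun i hi => Finset.sum_le_sum fun j hj => ?_)
      (sum_sq_smallPartMean_le hu hm (Finset.mem_powersetCard.1 hA).2 w hnn hle (hclr _ hw) hwA)
    refine pow_le_pow_left₀ (le_max_right _ _) (max_le_max_right 0 ?_) 2
    have h1 := le_iSup_of_mem_closure_range hφ₁b (continuous_smallPartMean_sub (exchange A i j)) hw
    have h2 := smallPartMean_sub_exchange hi (Finset.mem_sdiff.1 hj).2 w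
    rw [← h2]
    simp only [hW]
    linarith
  have hgE : ∫ d', testTrain S H d' ∂(drawLaw u m) = (∑ A ∈ P, g A) / (P.card : ℝ) :=
    integral_testSet g
  have hRE : transComplexityMin S (sqClass H) = (∑ A ∈ P, W A) / (P.card : ℝ) := by
    rw [← integral_testSet W]
    simp only [hW]
    unfold transComplexityMin smallPartMean
    split_ifs
    · rfl
    · rfl
  have hR0 : 0 ≤ transComplexityMin S (sqClass H) := by
    rw [hRE]
    refine div_nonneg ?_ (Nat.cast_nonneg _)
    obtain ⟨h⟩ : Nonempty (sqClass H) := inferInstance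
    rw [← sum_smallPartMean_sub_fullMean hu hm (φ₁ h)]
    exact Finset.sum_le_sum fun A _ =>
      le_ciSup (bddAbove_range_comp hφ₁b (continuous_smallPartMean_sub A)) h
  have hconc := slice_concentration Finset.univ u (Finset.card_pos.1 (by omega)) (by omega)
    g W hN hB hr hgV hWV hRE.symm hR0 hx
  rw [← hP] at hconc
  have hdev := deviation_le (E := (∑ A ∈ P, g A) / (P.card : ℝ)) hr hR0 hN hx
    (show 0 ≤ H₀ ^ 2 by positivity)
  rw [hgE]
  set b := (∑ A ∈ P, g A) / (P.card : ℝ) + 8 * Real.sqrt (3 * r * x / ((min u m : ℕ) : ℝ)) +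
    (⨅ α : Set.Ioi (0 : ℝ), (4 * transComplexityMin S (sqClass H) / α.1
      + 4 * α.1 * x / ((min u m : ℕ) : ℝ))) + 8 * H₀ ^ 2 * x / ((min u m : ℕ) : ℝ)
  have hprob : (drawLaw u m).real {d | testTrain S H d ≤ b} =
      ((P.filter fun A => g A ≤ b).card : ℝ) / (P.card : ℝ) :=
    drawLaw_real_testSet fun A => g A ≤ b
  have hPc : (0 : ℝ) < P.card := by
    exact_mod_cast Finset.card_pos.2 (Finset.powersetCard_nonempty.2 (by omega))
  rw [hprob, le_div_iff₀ hPc]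
  have hsplit : ((P.filter fun A => g A ≤ b).card : ℝ) +
      ((P.filter fun A => ¬ g A ≤ b).card : ℝ) = P.card := by
    exact_mod_cast Finset.card_filter_add_card_filter_not (s := P) fun A => g A ≤ b
  have hmono : ((P.filter fun A => ¬ g A ≤ b).card : ℝ) ≤ Real.exp (-x) * P.card := by
    refine le_trans ?_ hconc
    have hsub := Finset.monotone_filter_right P
      (p := fun A => ¬ g A ≤ b) (q := fun A => (∑ A ∈ P, g A) / (P.card : ℝ) +
        2 * Real.sqrt (8 * (4 * r + 2 * transComplexityMin S (sqClass H)) /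
          ((min u m : ℕ) : ℝ) * x) + 2 * H₀ ^ 2 / ((min u m : ℕ) : ℝ) * x < g A)
      (fun A _ hA => hdev.trans_lt (not_le.1 hA))
    exact_mod_cast Finset.card_le_card hsub
  linarith
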